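/- Let $\lambda\in(0,1)$ and $C>0$ be such that $\alpha_n:=C\lambda^n\in(0,\pi]$ for all $n\ge 1$, and put $A_n=e^{i\alpha_n}\in\mathbb{C}$. For $n\ge 1$ let $T_n$ be the midpoint of the segment $A_nA_{n+1}$; for $n\ge 2$ let $S_n$ be the point of the segment $A_{n-1}A_n$ with $|T_nA_n|=|A_nS_n|$, and let $C_n$ be the circular arc from $T_n$ to $S_n$, inside the triangle $A_nT_nS_n$, that is tangent to $A_nT_n$ at $T_n$ and to $A_nS_n$ at $S_n$. Let $\tau\in[0,\tfrac12]$ and $P=A_1+\tau(A_2-A_1)$. Let $u=e^{i(\alpha_1+\alpha_2)/2}$ be the outer unit normal to $A_1A_2$, and let $\rho\ge 0$ be the number with $|P-\rho u|=1-\rho$, that is, $\rho=\dfrac{1-|P|^2}{2(1-\langle P,u\rangle)}$. The circle with centre $P-\rho u$ and radius $\rho$ touches $A_1A_2$ at $P$ and touches the unit circle from inside at a point $Q$. Let $B$ be the counter-clockwise arc of this circle from $P$ to $Q$, and $D$ the counter-clockwise arc of the unit circle from $Q$, through the lower half-plane, to $1$. (If $\tau=0$, then $\rho=0$ and $P=Q=A_1$,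 so the corner at $A_1$ is left as it is; if $\tau>0$, it is rounded off.) Let $K=K_{\lambda,C,\tau}$ be the convex hull of $B\cup D\cup\bigcup_{n\ge2}C_n$. Then $K$ is a convex body (compact, convex, with non-empty interior) and: 1. If $\tau>0$, then $\partial K$ is of class $C^{1,1}$: it is a simple closed curve with a counter-clockwise, periodic, unit speed parametrization $z:\mathbb{R}\to\mathbb{C}$ that is differentiable with a uniformly Lipschitz derivative $z'$. 2. Every $x\in\mathbb{C}$ has a unique nearest point $\Pi(x)$ in $K$. With $c(t)=2e^{it/2}$, the unit speed curve along the circle of radius $2$ centred at $0$, we have $\Pi(c(0))=1\in\partial K$, and the one-sided derivative $$\lim_{t\searrow 0}\frac{\Pi(c(t))-\Pi(c(0))}{t}$$ does not exist. -/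

import Mathlib

open Set Filter Topology
open scoped NNReal ComplexConjugate

noncomputable section

namespace RoundedShapiro

/-- The angles `α_n = C λ^n`, used for `n ≥ 1`. -/
def ang (lam C : ℝ) (n : ℕ) : ℝ := C * lam ^ n

/-- The vertices `A_n = e^{i α_n}`; the first one is `A_1`. -/
def vertex (lam C : ℝ) (n : ℕ) : ℂ := Complex.exp (ang lam C n * Complex.I)

/-- `T_n`, the midpoint of the segment `A_n A_{n+1}`. -/
def ptT (lam C : ℝ) (n : ℕ) : ℂ := midpoint ℝ (vertex lam C n) (vertex lam C (n + 1))

/-- `S_n` (for `n ≥ 2`), the point at distance `|T_n A_n|` from `A_n` on the ray from `A_n`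
towards `A_{n-1}`. As `|T_n A_n| < |A_{n-1} A_n|`, it lies on the segment `A_{n-1} A_n`. -/
def ptS (lam C : ℝ) (n : ℕ) : ℂ :=
  AffineMap.lineMap (vertex lam C n) (vertex lam C (n - 1))
    (dist (ptT lam C n) (vertex lam C n) / dist (vertex lam C (n - 1)) (vertex lam C n))

/-- For a corner `A` and points `T`, `S` on its two sides, equally far from `A`: the circular arc
from `T` to `S` that is tangent to `AT` at `T` and to `AS` at `S`. It is the part inside the
triangle `A T S` of the circle through `T` and `S` whose radii at `T` and `S` are orthogonal to
the respective sides. -/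
def tangentArc (A T S : ℂ) : Set ℂ :=
  {w | w ∈ convexHull ℝ {A, T, S} ∧
    ∃ c : ℂ, inner ℝ (T - c) (T - A) = 0 ∧ inner ℝ (S - c) (S - A) = 0 ∧
      dist T c = dist S c ∧ dist w c = dist T c}

/-- The arc `C_n` (for `n ≥ 2`) replacing the two segments `T_n A_n` and `A_n S_n`. -/
def roundArc (lam C : ℝ) (n : ℕ) : Set ℂ :=
  tangentArc (vertex lam C n) (ptT lam C n) (ptS lam C n)

/-- The arc of the circle with centre `c` and radius `r`, from angle `a` to angle `b`. -/
def circArc (c : ℂ) (r a b : ℝ) : Set ℂ :=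
  (fun θ : ℝ => c + r * Complex.exp (θ * Complex.I)) '' Icc a b

/-!
The corner at `A_1`, between the unit circle and the segment `A_1 A_2`, is rounded off by an arc of
a circle that touches this segment from inside at the point `P = A_1 + τ (A_2 - A_1)` and touches
the unit circle from inside, with `0 ≤ τ ≤ 1/2`. For `τ = 0` this circle degenerates to the
point `A_1`, so that the corner is left as it is.
-/

/-- The direction angle of the outer normal to the segment `A_1 A_2`. -/
def firstAng (lam C : ℝ) : ℝ := (ang lam C 1 + ang lam C 2) / 2

/-- The point `P` of the segment `A_1 A_2` at which the rounding of the corner `A_1` starts. -/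
def firstPt (lam C τ : ℝ) : ℂ := AffineMap.lineMap (vertex lam C 1) (vertex lam C 2) τ

/-- The radius of the circle that rounds off the corner at `A_1`. With `u` the outer unit normal to
`A_1 A_2`, it is the solution `ρ` of `|P - ρ u| = 1 - ρ`, which says that the circle with
centre `P - ρ u` and radius `ρ` touches the unit circle from inside. -/
def firstRadius (lam C τ : ℝ) : ℝ :=
  (1 - ‖firstPt lam C τ‖ ^ 2) /
    (2 * (1 - inner ℝ (firstPt lam C τ) (Complex.exp (firstAng lam C * Complex.I))))

/-- The centre of the circle that rounds off the corner at `A_1`. -/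
def firstCenter (lam C τ : ℝ) : ℂ :=
  firstPt lam C τ - firstRadius lam C τ * Complex.exp (firstAng lam C * Complex.I)

/-- The direction angle, between `firstAng` and `firstAng + π`, of the point where that circle
touches the unit circle. It is the direction angle of the centre of that circle. -/
def firstEnd (lam C τ : ℝ) : ℝ :=
  firstAng lam C +
    Complex.arg (firstCenter lam C τ * Complex.exp (-(firstAng lam C * Complex.I)))

/-- The modified set of Shapiro: the convex hull of all arcs `C_n`, `n ≥ 2`, of the arc of the unit
circle that leads through the lower half-plane to `1`, and of the arc that rounds off
the corner at `A_1`. For `τ = 0` the unit arc starts at `A_1`, and the last arc is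
the point `A_1`. -/
def body (lam C τ : ℝ) : Set ℂ :=
  convexHull ℝ
    ((⋃ n ≥ 2, roundArc lam C n) ∪
      circArc (firstCenter lam C τ) (firstRadius lam C τ) (firstAng lam C) (firstEnd lam C τ) ∪
      circArc 0 1 (firstEnd lam C τ) (2 * Real.pi))

/-- The boundary of `K` is a closed simple curve `z` with a unit speed parametrization (of
period `L`), counter-clockwise (`K` lies to the left of each tangent line), which is differentiable
with a uniformly Lipschitz derivative. -/
def HasC11Boundary (K : Set ℂ) : Prop :=
  ∃ (z : ℝ → ℂ) (L : ℝ) (M : ℝ≥0), 0 < L ∧ Function.Periodic z L ∧ InjOn z (Ico 0 L) ∧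
    range z = frontier K ∧ Differentiable ℝ z ∧ (∀ s, ‖deriv z s‖ = 1) ∧
    LipschitzWith M (deriv z) ∧
    ∀ s, ∀ w ∈ K, 0 ≤ (conj (deriv z s) * (w - z s)).im

/-- `p` is a point of `K` nearest to `x`. -/
def IsNearest (K : Set ℂ) (x p : ℂ) : Prop := p ∈ K ∧ ∀ y ∈ K, dist x p ≤ dist x y

open Classical in
/-- The metric projection `Π` onto `K` (with the value `x` where there is no nearest point). -/
def metricProj (K : Set ℂ) (x : ℂ) : ℂ :=
  if h : ∃ p, IsNearest K x p then h.choose else x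

/-- The unit speed curve `c(t) = 2 e^{it/2}` along the circle of radius `2`. -/
def orbit (t : ℝ) : ℂ := 2 * Complex.exp (Complex.I * t / 2)

end RoundedShapiro

end

/-!
The generating set of `K` is a closed chain of circular arcs `D`, `B`, `C_2`, `C_3`, …, in which
consecutive arcs are joined by segments tangent to both (`ArcChain`, `ClosedArcChain`). Along such
a chain the normal angle is monotone, so going along it one moves in the direction `dir θ` while
the normal angle is in `[θ - π, θ]`, and in the opposite direction while it is in `[θ, θ + π]`.
Hence the point of the chain with normal `dir θ` is extremal in the direction `dir θ`
(`ClosedArcChain.inner_le_inner`), which gives all the supporting half-planes of `K`.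

*Smoothness.* The radii of the arcs `C_n` are bounded below, because the length of an edge and the
angle at its end are both proportional to `λ^n` (`arcRad_ge`), and for `τ > 0` the radius of `B`
is positive. Diminishing all radii by a small `r > 0` again yields a closed chain with the same
normals, and comparing its support function with that of `K` shows that a disc of radius `r` rolls
freely in `K` (`ClosedArcChain.roll`). In a body with this property the outer normal is a
Lipschitz function of the boundary point (`mul_norm_normal_sub_le`). The gauge function is
therefore differentiable along the unit circle, and the polar parametrization of the boundary can
be reparametrized by its length (`hasC11Boundary_of_roll_of_mem_nhds`).

*The projection.* The edge `A_n A_{n+1}` has a normal of angle `φ_n = α_n (1 + λ) / 2`, and a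
segment of it between `S_{n+1}` and `T_n` remains on the boundary of `K`. For large `n` and
`0 ≤ κ ≤ (1 - λ)² / 8`, the point of the orbit with direction angle `φ_n - κ α_n` projects
orthogonally to this segment. With `a = (1 + λ) / 2`, the difference quotients at these points
tend to `i (a - 2 κ) / (2 (a - κ))` (`eq_of_tendsto_slope`), and this limit depends on `κ`.
-/

namespace RoundedShapiro

/-! ### Convex bodies in which a disc rolls freely -/

/-- A boundary point of a convex body in which a disc of radius `r` rolls freely has an outer unit
normal `v`, and the disc of radius `r` that touches the boundary at this point from inside has its
centre on that normal. -/
theorem exists_unit_normal {K : Set ℂ} (hK : IsClosed K) (hconv : Convex ℝ K) {r : ℝ} (hr : 0 < r)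
    (hroll : ∀ x ∈ K, ∃ c, x ∈ Metric.closedBall c r ∧ Metric.closedBall c r ⊆ K)
    {x : ℂ} (hx : x ∈ frontier K) :
    ∃ v : ℂ, ‖v‖ = 1 ∧ Metric.closedBall (x - r • v) r ⊆ K ∧ ∀ y ∈ K, inner ℝ v (y - x) ≤ 0 := by
  have hxK : x ∈ K := hK.frontier_subset hx
  obtain ⟨c, hxc, hcK⟩ := hroll x hxK
  have hci : c ∈ interior K :=
    interior_mono (Metric.ball_subset_closedBall.trans hcK)
      (by rw [Metric.isOpen_ball.interior_eq]; exact Metric.mem_ball_self hr)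
  have hxi : x ∉ interior K := hx.2
  obtain ⟨f, hf⟩ := geometric_hahn_banach_open_point hconv.interior isOpen_interior hxi
  set w := (InnerProductSpace.toDual ℝ ℂ).symm f with hw
  have hfw : ∀ a, f a = inner ℝ w a := fun a => by
    rw [hw, InnerProductSpace.toDual_symm_apply]
  have hsupp : ∀ a ∈ K, f a ≤ f x := by
    intro a ha
    have hcl : K ⊆ closure (interior K) := by
      rw [hconv.closure_interior_eq_closure_of_nonempty_interior ⟨c, hci⟩]
      exact subset_closure
    exact closure_minimal (fun b hb => (hf b hb).le) (isClosed_le f.continuous continuous_const)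
      (hcl ha)
  have hw0 : 0 < ‖w‖ := by
    rw [norm_pos_iff]
    intro h0
    have := hf c hci
    simp [hfw, h0] at this
  set v : ℂ := ‖w‖⁻¹ • w with hv
  have hv1 : ‖v‖ = 1 := by
    rw [hv, norm_smul, norm_inv, norm_norm, inv_mul_cancel₀ hw0.ne']
  have hvs : ∀ y ∈ K, inner ℝ v (y - x) ≤ 0 := by
    intro y hy
    rw [hv, real_inner_smul_left, inner_sub_right, ← hfw, ← hfw]
    exact mul_nonpos_of_nonneg_of_nonpos (inv_nonneg.2 hw0.le) (sub_nonpos.2 (hsupp y hy))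
  -- the disc around `c` reaches no further in direction `v` than `x`, so that `x = c + r v`
  have h1 : r ≤ inner ℝ v (x - c) := by
    have hm : c + r • v ∈ K := hcK (by simp [Metric.mem_closedBall, hv1, abs_of_pos hr])
    have := hvs _ hm
    rw [show c + r • v - x = r • v - (x - c) by ring, inner_sub_right, real_inner_smul_right,
      real_inner_self_eq_norm_sq, hv1] at this
    linarith
  have h2 : ‖x - c‖ ≤ r := by simpa [Metric.mem_closedBall, dist_eq_norm] using hxc
  have h3 : ‖x - c - r • v‖ ^ 2 ≤ 0 := by
    rw [norm_sub_sq_real, real_inner_smul_right, norm_smul, hv1, real_inner_comm,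
      Real.norm_of_nonneg hr.le]
    nlinarith [norm_nonneg (x - c)]
  have h4 : x - r • v = c := by
    have : ‖x - c - r • v‖ = 0 := by
      have := norm_nonneg (x - c - r • v); nlinarith
    rw [norm_eq_zero] at this
    linear_combination this
  exact ⟨v, hv1, by rwa [h4], hvs⟩

/-- If a disc of radius `r` rolls freely in `K`, the outer unit normal is a Lipschitz function of
the boundary point, with constant `1 / r`. -/
theorem mul_norm_normal_sub_le {K : Set ℂ} {r : ℝ} (hr : 0 < r) {x y v w : ℂ}
    (hv1 : ‖v‖ = 1) (hw1 : ‖w‖ = 1)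
    (hvK : Metric.closedBall (x - r • v) r ⊆ K) (hwK : Metric.closedBall (y - r • w) r ⊆ K)
    (hv : ∀ y ∈ K, inner ℝ v (y - x) ≤ 0) (hw : ∀ x ∈ K, inner ℝ w (x - y) ≤ 0) :
    r * ‖v - w‖ ≤ ‖x - y‖ := by
  have h1 := hv (y - r • w + r • v)
    (hwK (by
      rw [Metric.mem_closedBall, dist_eq_norm, add_sub_cancel_left, norm_smul, hv1,
        Real.norm_of_nonneg hr.le, mul_one]))
  have h2 := hw (x - r • v + r • w)
    (hvK (by
      rw [Metric.mem_closedBall, dist_eq_norm, add_sub_cancel_left, norm_smul, hw1,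
        Real.norm_of_nonneg hr.le, mul_one]))
  have h3 : r * ‖v - w‖ ^ 2 ≤ inner ℝ (v - w) (x - y) := by
    rw [← real_inner_self_eq_norm_sq]
    have e1 : y - r • w + r • v - x = r • (v - w) - (x - y) := by rw [smul_sub]; ring
    have e2 : x - r • v + r • w - y = -(r • (v - w) - (x - y)) := by rw [smul_sub]; ring
    rw [e1] at h1
    rw [e2, inner_neg_right] at h2
    have : inner ℝ (v - w) (r • (v - w) - (x - y)) ≤ 0 := by
      rw [inner_sub_left]; linarith
    rw [inner_sub_right, real_inner_smul_right] at this
    linarith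
  have h4 := real_inner_le_norm (v - w) (x - y)
  rcases (norm_nonneg (v - w)).eq_or_lt with h | h
  · rw [← h]; simp
  · nlinarith

/-- The unit vector of direction angle `θ`. -/
noncomputable def dir (θ : ℝ) : ℂ := Complex.exp (θ * Complex.I)

theorem norm_dir (θ : ℝ) : ‖dir θ‖ = 1 := Complex.norm_exp_ofReal_mul_I θ

theorem dir_add (s t : ℝ) : dir (s + t) = dir s * dir t := by
  simp [dir, ← Complex.exp_add, add_mul]

theorem dir_eq (θ : ℝ) : dir θ = Real.cos θ + Real.sin θ * Complex.I := by
  simp [dir, Complex.exp_mul_I]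

theorem dir_re (θ : ℝ) : (dir θ).re = Real.cos θ := by simp [dir, Complex.exp_ofReal_mul_I_re]

theorem dir_im (θ : ℝ) : (dir θ).im = Real.sin θ := by simp [dir, Complex.exp_ofReal_mul_I_im]

theorem dir_ne_zero (θ : ℝ) : dir θ ≠ 0 := Complex.exp_ne_zero _

theorem dir_add_two_pi (θ : ℝ) : dir (θ + 2 * Real.pi) = dir θ := by
  apply Complex.ext <;> simp [dir_re, dir_im]

theorem hasDerivAt_dir (θ : ℝ) : HasDerivAt dir (Complex.I * dir θ) θ := by
  have h : HasDerivAt (fun t : ℝ => (t : ℂ) * Complex.I) Complex.I θ := by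
    simpa using (Complex.ofRealCLM.hasDerivAt (x := θ)).mul_const Complex.I
  have h1 := h.cexp
  rw [mul_comm] at h1
  exact h1

theorem continuous_dir : Continuous dir :=
  continuous_iff_continuousAt.2 fun θ => (hasDerivAt_dir θ).continuousAt

theorem lipschitz_dir (s t : ℝ) : ‖dir s - dir t‖ ≤ |s - t| := by
  have := Convex.norm_image_sub_le_of_norm_hasDerivWithin_le (f := dir)
    (f' := fun θ => Complex.I * dir θ) (s := univ) (C := 1) (x := t) (y := s)
    (fun θ _ => (hasDerivAt_dir θ).hasDerivWithinAt) (fun θ _ => by simp [norm_dir]) convex_univ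
    (mem_univ _) (mem_univ _)
  simpa using this

theorem eq_inner_dir_mul (v : ℂ) (θ : ℝ) :
    v = ((inner ℝ v (dir θ) : ℝ) + (inner ℝ v (Complex.I * dir θ) : ℝ) * Complex.I) * dir θ := by
  have e : (dir θ).re ^ 2 + (dir θ).im ^ 2 = 1 := by
    rw [dir_re, dir_im, Real.cos_sq_add_sin_sq]
  generalize dir θ = d at e
  apply Complex.ext
  · simp [Complex.inner]
    linear_combination (-v.re) * e
  · simp [Complex.inner]
    linear_combination (-v.im) * e

theorem injOn_dir : InjOn dir (Ico 0 (2 * Real.pi)) := by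
  intro s hs t ht h
  obtain ⟨k, hk⟩ := Complex.exp_eq_exp_iff_exists_int.1 h
  have h1 : s = t + k * (2 * Real.pi) := by
    have := congrArg Complex.im hk
    simpa using this
  have hpi := Real.two_pi_pos
  have h2 : (k : ℝ) < 1 := by
    by_contra! h
    nlinarith [hs.2, ht.1]
  have h3 : (-1 : ℝ) < k := by
    by_contra! h
    nlinarith [hs.1, ht.2]
  have h4 : k = 0 := by
    have : k < 1 := by exact_mod_cast h2
    have : -1 < k := by exact_mod_cast h3
    omega
  simpa [h4] using h1

/-- A planar convex body around the origin in which a disc of positive radius rolls freely has a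
boundary of class `C^{1,1}`. The boundary is parametrized by the direction angle; the
outer normal is continuous, so the gauge function is differentiable along the unit circle, and the
length `∫ k` as a function of the angle has an inverse. -/
theorem hasC11Boundary_of_roll_of_mem_nhds {K : Set ℂ} (hK : IsCompact K) (hconv : Convex ℝ K)
    (h0 : K ∈ 𝓝 (0 : ℂ)) {r : ℝ} (hr : 0 < r)
    (hroll : ∀ x ∈ K, ∃ c, x ∈ Metric.closedBall c r ∧ Metric.closedBall c r ⊆ K) :
    HasC11Boundary K := by
  have habs : Absorbent ℝ K := absorbent_nhds_zero h0
  have hbdd : Bornology.IsVonNBounded ℝ K := NormedSpace.isVonNBounded_of_isBounded ℝ hK.isBounded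
  obtain ⟨ε, hε, hεK⟩ := Metric.nhds_basis_closedBall.mem_iff.1 h0
  set g : ℝ → ℝ := fun φ => gauge K (dir φ) with hg
  have hgpos : ∀ φ, 0 < g φ := fun φ => (gauge_pos habs hbdd).2 (dir_ne_zero φ)
  have hgcont : Continuous g := (continuous_gauge hconv h0).comp continuous_dir
  set w : ℝ → ℂ := fun φ => (g φ)⁻¹ • dir φ with hw
  have hwcont : Continuous w :=
    (hgcont.inv₀ fun φ => (hgpos φ).ne').smul continuous_dir
  have hwfr : ∀ φ, w φ ∈ frontier K := by
    intro φ
    rw [← gauge_eq_one_iff_mem_frontier hconv h0, hw,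
      gauge_smul_of_nonneg (inv_nonneg.2 (hgpos φ).le)]
    exact inv_mul_cancel₀ (hgpos φ).ne'
  have hwK : ∀ φ, w φ ∈ K := fun φ => hK.isClosed.frontier_subset (hwfr φ)
  choose n hn1 hnK hns using
    fun φ => exists_unit_normal hK.isClosed hconv hr hroll (hwfr φ)
  have hnlip : ∀ φ ψ, r * ‖n φ - n ψ‖ ≤ ‖w φ - w ψ‖ := fun φ ψ =>
    mul_norm_normal_sub_le hr (hn1 φ) (hn1 ψ) (hnK φ) (hnK ψ) (hns φ) (hns ψ)
  have hndist : ∀ φ ψ, ‖n φ - n ψ‖ ≤ r⁻¹ * ‖w φ - w ψ‖ := fun φ ψ => by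
    rw [inv_mul_eq_div, le_div_iff₀ hr, mul_comm]; exact hnlip φ ψ
  have hncont : Continuous n := by
    rw [continuous_iff_continuousAt]
    intro φ
    rw [ContinuousAt, tendsto_iff_norm_sub_tendsto_zero]
    have h1 : Tendsto (fun ψ => r⁻¹ * ‖w ψ - w φ‖) (𝓝 φ) (𝓝 0) := by
      have := (tendsto_iff_norm_sub_tendsto_zero.1 (hwcont.tendsto φ)).const_mul r⁻¹
      simpa using this
    exact squeeze_zero (fun _ => norm_nonneg _) (fun ψ => hndist ψ φ) h1
  -- `a φ` is positive, since the disc of radius `ε` around the origin lies in `K`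
  set a : ℝ → ℝ := fun φ => inner ℝ (n φ) (dir φ) with ha
  have hacont : Continuous a := hncont.inner continuous_dir
  have hapos : ∀ φ, 0 < a φ := by
    intro φ
    have h1 := hns φ (ε • n φ) (hεK (by simp [hn1, abs_of_pos hε]))
    rw [hw, inner_sub_right, real_inner_smul_right, real_inner_smul_right,
      real_inner_self_eq_norm_sq, hn1] at h1
    have h2 : 0 < (g φ)⁻¹ * a φ := by simp only [ha]; linarith
    exact (mul_pos_iff_of_pos_left (inv_pos.2 (hgpos φ))).1 h2
  -- the subgradient of the gauge at `dir φ`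
  set p : ℝ → ℂ := fun φ => (g φ / a φ) • n φ with hp
  have hpcont : Continuous p := (hgcont.div hacont fun φ => (hapos φ).ne').smul hncont
  have hpself : ∀ φ, inner ℝ (p φ) (dir φ) = g φ := fun φ => by
    simp only [hp, real_inner_smul_left]
    exact div_mul_cancel₀ _ (hapos φ).ne'
  have hple : ∀ φ ψ, inner ℝ (p φ) (dir ψ) ≤ g ψ := by
    intro φ ψ
    have h1 := hns φ (w ψ) (hwK ψ)
    simp only [hw, inner_sub_right, real_inner_smul_right] at h1
    simp only [hp, real_inner_smul_left]
    have h2 : (g ψ)⁻¹ * inner ℝ (n φ) (dir ψ) ≤ (g φ)⁻¹ * a φ := by simp only [ha]; linarith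
    rw [inv_mul_eq_div, inv_mul_eq_div, div_le_div_iff₀ (hgpos ψ) (hgpos φ)] at h2
    rw [div_mul_eq_mul_div, div_le_iff₀ (hapos φ)]
    linarith
  have hgd : ∀ φ, HasDerivAt g (inner ℝ (p φ) (Complex.I * dir φ)) φ := by
    intro φ
    have h1 : HasDerivAt (fun ψ => inner ℝ (p φ) (dir ψ))
        (inner ℝ (p φ) (Complex.I * dir φ)) φ := by
      simpa using (hasDerivAt_const φ (p φ)).inner ℝ (hasDerivAt_dir φ)
    have h2 : HasDerivAt (fun ψ => g ψ - inner ℝ (p φ) (dir ψ)) 0 φ := by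
      rw [hasDerivAt_iff_isLittleO]
      simp only [hpself, smul_zero, sub_zero, sub_self]
      rw [Asymptotics.isLittleO_iff]
      intro c hc
      have h3 : ∀ᶠ ψ in 𝓝 φ, ‖p ψ - p φ‖ < c := by
        have := tendsto_iff_norm_sub_tendsto_zero.1 (hpcont.tendsto φ)
        exact this.eventually (gt_mem_nhds hc)
      filter_upwards [h3] with ψ hψ
      have h4 : g ψ - inner ℝ (p φ) (dir ψ) ≤ inner ℝ (p ψ - p φ) (dir ψ - dir φ) := by
        have := hple ψ φ
        rw [inner_sub_left, inner_sub_right, inner_sub_right, hpself, hpself]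
        linarith
      rw [Real.norm_of_nonneg (sub_nonneg.2 (hple φ ψ)), Real.norm_eq_abs]
      calc _ ≤ ‖p ψ - p φ‖ * ‖dir ψ - dir φ‖ := h4.trans (real_inner_le_norm _ _)
        _ ≤ c * |ψ - φ| := mul_le_mul hψ.le (lipschitz_dir ψ φ) (norm_nonneg _) hc.le
    have h3 := h2.add h1
    rw [zero_add] at h3
    exact h3.congr_of_eventuallyEq (Eventually.of_forall fun ψ => (sub_add_cancel _ _).symm)
  -- hence the curve `w` is differentiable, and its derivative is a multiple of the tangent vector
  set k : ℝ → ℝ := fun φ => (g φ * a φ)⁻¹ with hk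
  have hkpos : ∀ φ, 0 < k φ := fun φ => inv_pos.2 (mul_pos (hgpos φ) (hapos φ))
  have hkcont : Continuous k :=
    (hgcont.mul hacont).inv₀ fun φ => (mul_pos (hgpos φ) (hapos φ)).ne'
  have hwd : ∀ φ, HasDerivAt w (k φ • (Complex.I * n φ)) φ := by
    intro φ
    have h1 := ((hgd φ).inv (hgpos φ).ne').smul (hasDerivAt_dir φ)
    refine h1.congr_deriv ?_
    have hg0 : (g φ : ℂ) ≠ 0 := Complex.ofReal_ne_zero.2 (hgpos φ).ne'
    have ha0 : (a φ : ℂ) ≠ 0 := Complex.ofReal_ne_zero.2 (hapos φ).ne'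
    set b : ℝ := inner ℝ (n φ) (Complex.I * dir φ) with hb
    have hnd : n φ = (a φ + b * Complex.I) * dir φ := eq_inner_dir_mul (n φ) φ
    simp only [hp, hk, real_inner_smul_left, ← hb, Pi.inv_apply]
    simp only [Complex.real_smul]
    rw [hnd]
    push_cast
    field_simp
    ring_nf
    simp only [Complex.I_sq]
    ring
  have hwper : ∀ φ, w (φ + 2 * Real.pi) = w φ := fun φ => by
    simp only [hw, hg, dir_add_two_pi]
  have hnper : ∀ φ, n (φ + 2 * Real.pi) = n φ := fun φ => by
    have := hnlip (φ + 2 * Real.pi) φ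
    rw [hwper, sub_self, norm_zero] at this
    have h2 : ‖n (φ + 2 * Real.pi) - n φ‖ ≤ 0 := by
      by_contra! h
      exact absurd (mul_pos hr h) (not_lt.2 this)
    exact sub_eq_zero.1 (norm_le_zero_iff.1 h2)
  have hkper : Function.Periodic k (2 * Real.pi) := fun φ => by
    simp only [hk, ha, hg, dir_add_two_pi, hnper]
  have hkε : ∀ φ, ε ≤ k φ := by
    intro φ
    have h1 : ε * g φ ≤ 1 := by
      have := mul_gauge_le_norm (Metric.ball_subset_closedBall.trans hεK) (x := dir φ)
      rwa [norm_dir] at this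
    have h2 : a φ ≤ 1 := by
      have := real_inner_le_norm (n φ) (dir φ)
      rwa [hn1, norm_dir, mul_one] at this
    simp only [hk]
    rw [le_inv_comm₀ hε (mul_pos (hgpos φ) (hapos φ))]
    have h3 : g φ ≤ ε⁻¹ := by
      rw [le_inv_comm₀ (hgpos φ) hε, ← one_div, le_div_iff₀ (hgpos φ)]
      exact h1
    nlinarith [hgpos φ, hapos φ]
  -- the length of the boundary as a function of the direction angle, and its inverse
  set σ : ℝ → ℝ := fun φ => ∫ t in (0 : ℝ)..φ, k t with hσ
  have hσd : ∀ φ, HasDerivAt σ (k φ) φ := fun φ =>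
    hkcont.integral_hasStrictDerivAt 0 φ |>.hasDerivAt
  have hσmono : StrictMono σ := strictMono_of_hasDerivAt_pos hσd hkpos
  have hσcont : Continuous σ := continuous_iff_continuousAt.2 fun φ => (hσd φ).continuousAt
  have hσmono' : Monotone fun φ => σ φ - ε * φ := by
    refine monotone_of_hasDerivAt_nonneg (f' := fun φ => k φ - ε) (fun φ => ?_) fun φ => ?_
    · have h1 := (hσd φ).sub ((hasDerivAt_id φ).const_mul ε)
      rw [mul_one] at h1
      exact h1
    · exact sub_nonneg.2 (hkε φ)
  have hσ0 : σ 0 = 0 := by simp [hσ]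
  have hσtop : Tendsto σ atTop atTop := by
    refine tendsto_atTop_mono' _ ?_ (tendsto_id.const_mul_atTop hε)
    filter_upwards [eventually_ge_atTop 0] with φ hφ
    have := hσmono' hφ
    simp only [hσ0, mul_zero, sub_zero] at this
    simpa using this
  have hσbot : Tendsto σ atBot atBot := by
    refine tendsto_atBot_mono' _ ?_ (tendsto_id.const_mul_atBot hε)
    filter_upwards [eventually_le_atBot 0] with φ hφ
    have := hσmono' hφ
    simp only [hσ0, mul_zero, sub_zero] at this
    simpa using this
  have hσsurj : Function.Surjective σ := hσcont.surjective hσtop hσbot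
  set Φ := (StrictMono.orderIsoOfSurjective σ hσmono hσsurj) with hΦ
  have hΦσ : ∀ φ, Φ.symm (σ φ) = φ := fun φ => Φ.symm_apply_apply φ
  have hσΦ : ∀ s, σ (Φ.symm s) = s := fun s => Φ.apply_symm_apply s
  have hΦd : ∀ s, HasDerivAt Φ.symm (k (Φ.symm s))⁻¹ s := fun s =>
    HasDerivAt.of_local_left_inverse Φ.symm.continuous.continuousAt (hσd _) (hkpos _).ne'
      (Eventually.of_forall hσΦ)
  set L := σ (2 * Real.pi) with hL
  have hσper : ∀ φ, σ (φ + 2 * Real.pi) = σ φ + L := by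
    intro φ
    have h1 := hkper.intervalIntegral_add_eq φ 0
    rw [zero_add] at h1
    simp only [hL, hσ]
    rw [← h1, intervalIntegral.integral_add_adjacent_intervals] <;>
      exact hkcont.intervalIntegrable _ _
  have hΦper : ∀ s, Φ.symm (s + L) = Φ.symm s + 2 * Real.pi := by
    intro s
    apply hσmono.injective
    rw [hσΦ, hσper, hσΦ]
  have hLpos : 0 < L := by
    rw [hL, ← hσ0]; exact hσmono Real.two_pi_pos
  set z : ℝ → ℂ := fun s => w (Φ.symm s) with hz
  have hzd : ∀ s, HasDerivAt z (Complex.I * n (Φ.symm s)) s := by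
    intro s
    have h1 := (hwd (Φ.symm s)).scomp s (hΦd s)
    refine h1.congr_deriv ?_
    rw [smul_smul, inv_mul_cancel₀ (hkpos _).ne', one_smul]
  have hzderiv : ∀ s, deriv z s = Complex.I * n (Φ.symm s) := fun s => (hzd s).deriv
  have hzlip : ∀ s t, ‖z s - z t‖ ≤ ‖s - t‖ := by
    intro s t
    have := Convex.norm_image_sub_le_of_norm_hasDerivWithin_le (f := z)
      (f' := fun s => Complex.I * n (Φ.symm s)) (s := univ) (C := 1) (x := t) (y := s)
      (fun θ _ => (hzd θ).hasDerivWithinAt) (fun θ _ => by simp [hn1]) convex_univ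
      (mem_univ _) (mem_univ _)
    simpa using this
  have hwinj : ∀ φ ψ, w φ = w ψ → dir φ = dir ψ := by
    intro φ ψ h
    have h1 : ‖w φ‖ = ‖w ψ‖ := by rw [h]
    simp only [hw, norm_smul, norm_dir, mul_one, Real.norm_eq_abs,
      abs_of_pos (inv_pos.2 (hgpos _))] at h1
    simp only [hw, h1] at h
    exact smul_right_injective ℂ (inv_pos.2 (hgpos ψ)).ne' h
  refine ⟨z, L, Real.toNNReal r⁻¹, hLpos, fun s => ?_, ?_, ?_, fun s => (hzd s).differentiableAt,
    fun s => ?_, ?_, ?_⟩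
  · simp only [hz, hΦper, hwper]
  · intro s hs t ht hst
    have hmem : ∀ s ∈ Ico 0 L, Φ.symm s ∈ Ico 0 (2 * Real.pi) := by
      intro s hs
      constructor
      · rw [← hσmono.le_iff_le, hσΦ, hσ0]; exact hs.1
      · rw [← hσmono.lt_iff_lt, hσΦ]; exact hs.2
    have h1 := hwinj _ _ hst
    exact Φ.symm.injective (injOn_dir (hmem s hs) (hmem t ht) h1)
  · apply Subset.antisymm
    · rintro _ ⟨s, rfl⟩
      exact hwfr _
    · intro x hx
      refine ⟨σ x.arg, ?_⟩
      have h1 : gauge K x = 1 := (gauge_eq_one_iff_mem_frontier hconv h0).2 hx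
      have h2 : ‖x‖ • dir x.arg = x := by
        rw [Complex.real_smul, dir, Complex.norm_mul_exp_arg_mul_I]
      have h3 : ‖x‖ * g x.arg = 1 := by
        rw [← h2, gauge_smul_of_nonneg (norm_nonneg _)] at h1
        exact h1
      simp only [hz, hw, hΦσ]
      rw [← eq_inv_of_mul_eq_one_left h3, h2]
  · rw [hzderiv, norm_mul, Complex.norm_I, hn1, one_mul]
  · refine LipschitzWith.of_dist_le_mul fun s t => ?_
    rw [hzderiv, hzderiv, dist_eq_norm, ← mul_sub, norm_mul, Complex.norm_I, one_mul,
      Real.coe_toNNReal _ (inv_nonneg.2 hr.le), dist_eq_norm]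
    exact (hndist _ _).trans (mul_le_mul_of_nonneg_left (hzlip s t) (inv_nonneg.2 hr.le))
  · intro s y hy
    have h1 := hns (Φ.symm s) y hy
    rw [hzderiv]
    simp only [Complex.inner] at h1
    simp only [hz, map_mul, Complex.conj_I]
    simp at h1 ⊢
    linarith

/-! ### Convex chains of circular arcs -/

theorem inner_dir_dir (s θ : ℝ) : inner ℝ (dir s) (dir θ) = Real.cos (θ - s) := by
  simp only [Complex.inner, Complex.mul_re, Complex.conj_re, Complex.conj_im, dir_re, dir_im,
    Real.cos_sub]
  ring

theorem inner_I_mul_dir_dir (s θ : ℝ) :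
    inner ℝ (Complex.I * dir s) (dir θ) = Real.sin (θ - s) := by
  simp only [Complex.inner, Complex.mul_re, Complex.mul_im, Complex.conj_re, Complex.conj_im,
    Complex.I_re, Complex.I_im, dir_re, dir_im, Real.sin_sub]
  ring

theorem dir_add_pi (θ : ℝ) : dir (θ + Real.pi) = -dir θ := by
  apply Complex.ext <;> simp [dir_re, dir_im]

theorem dir_sub_pi (θ : ℝ) : dir (θ - Real.pi) = -dir θ := by
  apply Complex.ext <;> simp [dir_re, dir_im]

theorem exists_eq_smul_dir (w : ℂ) :
    ∃ θ ∈ Ioc 0 (2 * Real.pi), w = ‖w‖ • dir θ := by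
  have h2 : w = ‖w‖ • dir w.arg := by
    rw [Complex.real_smul, dir, Complex.norm_mul_exp_arg_mul_I]
  by_cases h : 0 < w.arg
  · exact ⟨w.arg, ⟨h, by linarith [Complex.arg_le_pi w, Real.pi_pos]⟩, h2⟩
  · refine ⟨w.arg + 2 * Real.pi, ⟨?_, by linarith⟩, by rwa [dir_add_two_pi]⟩
    linarith [Complex.neg_pi_lt_arg w, Real.pi_pos]

/-- A convex chain of circular arcs. The arc number `n` has centre `c n` and radius `R n`, and its
outer normals have the direction angles in `[β (n + 1), β n]`. The end point of the arc number
`n + 1` is joined to the starting point of the arc number `n` by a segment (possibly of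
length `0`) that is tangent to both. Counter-clockwise, the chain is run through with decreasing
numbers. -/
structure ArcChain (β : ℕ → ℝ) (c : ℕ → ℂ) (R : ℕ → ℝ) : Prop where
  anti : Antitone β
  nonneg : ∀ n, 0 ≤ R n
  gap : ∀ n, ∃ l : ℝ, 0 ≤ l ∧ c n + R n • dir (β (n + 1)) =
    c (n + 1) + R (n + 1) • dir (β (n + 1)) + l • (Complex.I * dir (β (n + 1)))

/-- Going along a convex chain, one moves in the direction of `dir θ` as long as the angle of
the normal is in `[θ - π, θ]`. -/
theorem ArcChain.inner_le {β : ℕ → ℝ} {c : ℕ → ℂ} {R : ℕ → ℝ} (h : ArcChain β c R) {m : ℕ}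
    {t θ : ℝ} (ht : t ∈ Icc (β (m + 1)) (β m)) (htθ : t ≤ θ) {n : ℕ} (hmn : m ≤ n) :
    ∀ s ∈ Icc (β (n + 1)) (β n), s ≤ t → θ ≤ s + Real.pi →
      inner ℝ (c n + R n • dir s) (dir θ) ≤ (inner ℝ (c m + R m • dir t) (dir θ) : ℝ) := by
  have arc : ∀ n s t, s ≤ t → t ≤ θ → θ ≤ s + Real.pi →
      inner ℝ (c n + R n • dir s) (dir θ) ≤ (inner ℝ (c n + R n • dir t) (dir θ) : ℝ) := by
    intro n s t hst htθ hθ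
    rw [inner_add_left, inner_add_left, real_inner_smul_left, real_inner_smul_left, inner_dir_dir,
      inner_dir_dir]
    have := Real.cos_le_cos_of_nonneg_of_le_pi (x := θ - t) (y := θ - s) (by linarith)
      (by linarith) (by linarith)
    have := mul_le_mul_of_nonneg_left this (h.nonneg n)
    linarith
  induction n, hmn using Nat.le_induction with
  | base => exact fun s _ hst hθ => arc m s t hst htθ hθ
  | succ n hmn ih =>
    intro s hs hst hθ
    have hβt : β (n + 1) ≤ t := (h.anti (by omega)).trans ht.1
    have h1 := arc (n + 1) s (β (n + 1)) hs.2 (hβt.trans htθ) hθ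
    have h2 := ih (β (n + 1)) ⟨le_rfl, h.anti n.le_succ⟩ hβt
      (hθ.trans (add_le_add_left hs.2 _))
    obtain ⟨l, hl, hg⟩ := h.gap n
    rw [hg, inner_add_left, real_inner_smul_left, inner_I_mul_dir_dir] at h2
    have h3 : 0 ≤ Real.sin (θ - β (n + 1)) :=
      Real.sin_nonneg_of_nonneg_of_le_pi (by linarith) (by linarith [hs.2])
    have h4 := mul_nonneg hl h3
    linarith

/-- A chain that closes up after a full turn: its far end, with normal angles decreasing to `0`,
converges to its other end point, with normal angle `2π`. -/
structure ClosedArcChain (β : ℕ → ℝ) (c : ℕ → ℂ) (R : ℕ → ℝ) : Prop extends ArcChain β c R where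
  start : β 0 = 2 * Real.pi
  angle_tendsto : Tendsto β atTop (𝓝 0)
  tendsto : Tendsto (fun n => c n + R n • dir (β (n + 1))) atTop (𝓝 (c 0 + R 0 • dir (β 0)))

namespace ClosedArcChain

variable {β : ℕ → ℝ} {c : ℕ → ℂ} {R : ℕ → ℝ}

theorem angle_nonneg (h : ClosedArcChain β c R) (n : ℕ) : 0 ≤ β n :=
  h.anti.le_of_tendsto h.angle_tendsto n

theorem exists_mem_arc (h : ClosedArcChain β c R) {θ : ℝ} (hθ : θ ∈ Ioc 0 (2 * Real.pi)) :
    ∃ m, θ ∈ Icc (β (m + 1)) (β m) := by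
  have hex : ∃ n, β n < θ := (h.angle_tendsto.eventually (gt_mem_nhds hθ.1)).exists
  classical
  have hN := Nat.find_spec hex
  have hmin := fun m => Nat.find_min hex (m := m)
  cases hfind : Nat.find hex with
  | zero => rw [hfind, h.start] at hN; exact absurd hθ.2 (not_le.2 hN)
  | succ m =>
    rw [hfind] at hN
    exact ⟨m, hN.le, not_lt.1 (hmin m (by omega))⟩

/-- The support property of a closed chain: the point with normal `dir θ` is extremal in the
direction `dir θ`. -/
theorem inner_le_inner (h : ClosedArcChain β c R) {m n : ℕ} {s θ : ℝ}
    (hθ : θ ∈ Icc (β (m + 1)) (β m)) (hs : s ∈ Icc (β (n + 1)) (β n)) :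
    inner ℝ (c n + R n • dir s) (dir θ) ≤ (inner ℝ (c m + R m • dir θ) (dir θ) : ℝ) := by
  have hpi := Real.pi_pos
  have hβ0 : ∀ n, β n ≤ 2 * Real.pi := fun n => h.start ▸ h.anti (Nat.zero_le n)
  have hend : β 0 ∈ Icc (β (0 + 1)) (β 0) := ⟨h.anti (Nat.zero_le _), le_rfl⟩
  have hfar : ∀ N, β (N + 1) ∈ Icc (β (N + 1)) (β N) := fun N => ⟨le_rfl, h.anti N.le_succ⟩
  have hlim : Tendsto (fun N => (inner ℝ (c N + R N • dir (β (N + 1))) (dir θ) : ℝ)) atTop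
      (𝓝 (inner ℝ (c 0 + R 0 • dir (β 0)) (dir θ))) := h.tendsto.inner tendsto_const_nhds
  have hcase : (s ≤ θ ∧ m ≤ n) ∨ (θ ≤ s ∧ n ≤ m) := by
    rcases lt_trichotomy m n with hmn | rfl | hmn
    · exact Or.inl ⟨hs.2.trans ((h.anti hmn).trans hθ.1), hmn.le⟩
    · exact (le_total s θ).imp (⟨·, le_rfl⟩) (⟨·, le_rfl⟩)
    · exact Or.inr ⟨hθ.2.trans ((h.anti hmn).trans hs.1), hmn.le⟩
  rcases hcase with ⟨hsθ, hmn⟩ | ⟨hsθ, hmn⟩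
  · rcases le_total θ (s + Real.pi) with h1 | h1
    · exact h.inner_le hθ le_rfl hmn s hs hsθ h1
    · -- go from `θ` up to `2π`, and on from `0` up to `s`
      have hθπ : Real.pi ≤ θ := by linarith [h.angle_nonneg (n + 1), hs.1]
      have h2 := h.inner_le (θ := θ + Real.pi) hend (by rw [h.start]; linarith) (Nat.zero_le m) θ hθ
        (by rw [h.start]; exact hθ.2.trans (hβ0 m)) le_rfl
      rw [dir_add_pi, inner_neg_right, inner_neg_right, neg_le_neg_iff] at h2
      refine le_trans (ge_of_tendsto hlim ?_) h2
      filter_upwards [eventually_ge_atTop (n + 1)] with N hN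
      have h3 := h.inner_le (θ := θ - Real.pi) hs (by linarith) (by omega : n ≤ N) _ (hfar N)
        ((h.anti (by omega)).trans hs.1) (by linarith [hθ.2, hβ0 m, h.angle_nonneg (N + 1)])
      rwa [dir_sub_pi, inner_neg_right, inner_neg_right, neg_le_neg_iff] at h3
  · rcases le_total s (θ + Real.pi) with h1 | h1
    · have h2 := h.inner_le (θ := θ + Real.pi) hs h1 hmn θ hθ hsθ le_rfl
      rwa [dir_add_pi, inner_neg_right, inner_neg_right, neg_le_neg_iff] at h2
    · -- go from `s` up to `2π`, and on from `0` up to `θ`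
      have h2 := h.inner_le (θ := θ + 2 * Real.pi) hend
        (by rw [h.start]; linarith [h.angle_nonneg (m + 1), hθ.1]) (Nat.zero_le n) s hs
        (by rw [h.start]; exact hs.2.trans (hβ0 n)) (by linarith)
      rw [dir_add_two_pi] at h2
      refine h2.trans (le_of_tendsto hlim ?_)
      filter_upwards [eventually_ge_atTop (m + 1)] with N hN
      exact h.inner_le hθ le_rfl (by omega) _ (hfar N) ((h.anti (by omega)).trans hθ.1)
        (by linarith [hs.2, hβ0 n, h.angle_nonneg (N + 1)])

end ClosedArcChain

/-- The union of the arcs of a chain. -/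
def chainArcs (β : ℕ → ℝ) (c : ℕ → ℂ) (R : ℕ → ℝ) : Set ℂ :=
  ⋃ n, circArc (c n) (R n) (β (n + 1)) (β n)

theorem mem_chainArcs {β : ℕ → ℝ} {c : ℕ → ℂ} {R : ℕ → ℝ} {x : ℂ} :
    x ∈ chainArcs β c R ↔ ∃ n, ∃ s ∈ Icc (β (n + 1)) (β n), c n + R n • dir s = x := by
  simp [chainArcs, circArc, dir]

/-- The supporting half-plane, with outer normal `dir θ`, of the convex hull of a closed chain. -/
theorem ClosedArcChain.inner_le_of_mem_convexHull {β : ℕ → ℝ} {c : ℕ → ℂ} {R : ℕ → ℝ}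
    (h : ClosedArcChain β c R) {m : ℕ} {θ : ℝ} (hθ : θ ∈ Icc (β (m + 1)) (β m)) {y : ℂ}
    (hy : y ∈ convexHull ℝ (chainArcs β c R)) :
    inner ℝ y (dir θ) ≤ (inner ℝ (c m + R m • dir θ) (dir θ) : ℝ) := by
  have hsub : convexHull ℝ (chainArcs β c R) ⊆
      {y | inner ℝ y (dir θ) ≤ (inner ℝ (c m + R m • dir θ) (dir θ) : ℝ)} := by
    refine convexHull_min ?_ ?_
    · intro x hx
      obtain ⟨n, s, hs, rfl⟩ := mem_chainArcs.1 hx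
      exact h.inner_le_inner hθ hs
    · exact convex_halfSpace_le ⟨fun x y => inner_add_left x y _,
        fun a x => real_inner_smul_left x _ a⟩ _
  exact hsub hy

/-- The points covered by a disc of radius `r` inside a convex set form a convex set. -/
theorem convex_setOf_roll {K : Set ℂ} (hconv : Convex ℝ K) (r : ℝ) :
    Convex ℝ {x | ∃ c, x ∈ Metric.closedBall c r ∧ Metric.closedBall c r ⊆ K} := by
  rintro x ⟨c, hx, hc⟩ y ⟨d, hy, hd⟩ a b ha hb hab
  refine ⟨a • c + b • d, ?_, fun z hz => ?_⟩
  · rw [Metric.mem_closedBall, dist_eq_norm] at hx hy ⊢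
    calc _ = ‖a • (x - c) + b • (y - d)‖ := by congr 1; module
      _ ≤ a * ‖x - c‖ + b * ‖y - d‖ := by
          refine (norm_add_le _ _).trans_eq ?_
          rw [norm_smul, norm_smul, Real.norm_of_nonneg ha, Real.norm_of_nonneg hb]
      _ ≤ a * r + b * r := by gcongr
      _ = r := by rw [← add_mul, hab, one_mul]
  · have hz' : ∀ e, e + (z - (a • c + b • d)) ∈ Metric.closedBall e r := fun e => by
      rw [Metric.mem_closedBall, dist_eq_norm] at hz ⊢
      rwa [add_sub_cancel_left]
    have := hconv (hc (hz' c)) (hd (hz' d)) ha hb hab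
    convert this using 1
    have hb' : b = 1 - a := by linarith
    subst hb'
    module

/-- If the arcs of a closed chain still form a closed chain after their radii are diminished by
`r`, then a disc of radius `r` rolls freely in their convex hull. -/
theorem ClosedArcChain.roll {β : ℕ → ℝ} {c : ℕ → ℂ} {R : ℕ → ℝ} {r : ℝ} (hr : 0 ≤ r)
    (h : ClosedArcChain β c fun n => R n - r)
    (hcl : IsClosed (convexHull ℝ (chainArcs β c R))) :
    ∀ x ∈ convexHull ℝ (chainArcs β c R),
      ∃ d, x ∈ Metric.closedBall d r ∧ Metric.closedBall d r ⊆ convexHull ℝ (chainArcs β c R) := by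
  refine convexHull_min ?_ (convex_setOf_roll (convex_convexHull ℝ _) r)
  intro x hx
  obtain ⟨n, s, hs, rfl⟩ := mem_chainArcs.1 hx
  refine ⟨c n + (R n - r) • dir s, ?_, fun p hp => ?_⟩
  · rw [Metric.mem_closedBall, dist_eq_norm, add_sub_add_left_eq_sub, ← sub_smul, sub_sub_cancel,
      norm_smul, norm_dir, mul_one, Real.norm_of_nonneg hr]
  -- a point of the disc outside the hull would be separated from it by some normal `dir θ`
  by_contra hpK
  obtain ⟨f, u, hfu, huf⟩ := geometric_hahn_banach_closed_point (convex_convexHull ℝ _) hcl hpK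
  set w := (InnerProductSpace.toDual ℝ ℂ).symm f with hw
  have hfw : ∀ a, f a = inner ℝ w a := fun a => by
    rw [hw, InnerProductSpace.toDual_symm_apply]
  obtain ⟨θ, hθ, hwθ⟩ := exists_eq_smul_dir w
  obtain ⟨m, hm⟩ := h.exists_mem_arc hθ
  have h1 := hfu (c m + R m • dir θ) (subset_convexHull ℝ _ (mem_chainArcs.2 ⟨m, θ, hm, rfl⟩))
  have h2 := h1.trans huf
  rw [hfw, hfw, hwθ, real_inner_smul_left, real_inner_smul_left] at h2
  have h3 := lt_of_mul_lt_mul_left h2 (norm_nonneg w)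
  have h4 := h.inner_le_inner hm hs
  have h5 : inner ℝ (dir θ) (p - (c n + (R n - r) • dir s)) ≤ r := by
    refine (real_inner_le_norm _ _).trans ?_
    rw [norm_dir, one_mul, ← dist_eq_norm]
    exact hp
  rw [inner_sub_right] at h5
  rw [real_inner_comm, real_inner_comm (dir θ)] at h4
  have h6 : c m + R m • dir θ = c m + (R m - r) • dir θ + r • dir θ := by module
  rw [h6, inner_add_right, real_inner_smul_right, real_inner_self_eq_norm_sq, norm_dir] at h3
  linarith

/-! ### The arc inscribed in a corner -/

theorem inner_dir_I_mul_dir (s θ : ℝ) :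
    inner ℝ (dir s) (Complex.I * dir θ) = Real.sin (s - θ) := by
  rw [real_inner_comm, inner_I_mul_dir_dir]

theorem combo_mem_convexHull_triple {A T S : ℂ} {a b c : ℝ} (ha : 0 ≤ a) (hb : 0 ≤ b)
    (hc : 0 ≤ c) (habc : a + b + c = 1) : a • A + b • T + c • S ∈ convexHull ℝ {A, T, S} := by
  have h := (convex_convexHull ℝ ({A, T, S} : Set ℂ)).sum_mem (t := Finset.univ)
    (w := ![a, b, c]) (z := ![A, T, S]) (by intro i _; fin_cases i <;> simpa)
    (by simpa [Fin.sum_univ_three] using habc)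
    (by intro i _; apply subset_convexHull; fin_cases i <;> simp)
  simpa [Fin.sum_univ_three] using h

/-- The apex of the corner, seen from the first touching point. -/
theorem div_cos_smul_dir_eq_sub {η : ℝ} (hη : Real.cos η ≠ 0) (r μ : ℝ) :
    (r / Real.cos η) • dir μ =
      r • dir (μ - η) + (r * Real.sin η / Real.cos η) • (Complex.I * dir (μ - η)) := by
  have hc : (Real.cos η : ℂ) ≠ 0 := Complex.ofReal_ne_zero.2 hη
  have h : dir μ = dir (μ - η) * dir η := by rw [← dir_add, sub_add_cancel]
  rw [h, dir_eq η]
  simp only [Complex.real_smul, Complex.ofReal_div, Complex.ofReal_mul]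
  field_simp

/-- The apex of the corner, seen from the second touching point. -/
theorem div_cos_smul_dir_eq_add {η : ℝ} (hη : Real.cos η ≠ 0) (r μ : ℝ) :
    (r / Real.cos η) • dir μ =
      r • dir (μ + η) - (r * Real.sin η / Real.cos η) • (Complex.I * dir (μ + η)) := by
  have h := div_cos_smul_dir_eq_sub (η := -η) (by rwa [Real.cos_neg]) r μ
  rw [Real.cos_neg, Real.sin_neg, sub_neg_eq_add] at h
  rw [h, mul_neg, neg_div, neg_smul, ← sub_eq_add_neg]

theorem tangentArc_eq_circArc (c : ℂ) {r μ η : ℝ} (hr : 0 < r) (hη : η ∈ Ioo 0 (Real.pi / 2)) :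
    tangentArc (c + (r / Real.cos η) • dir μ) (c + r • dir (μ - η)) (c + r • dir (μ + η)) =
      circArc c r (μ - η) (μ + η) := by
  have hcos : 0 < Real.cos η :=
    Real.cos_pos_of_mem_Ioo ⟨by linarith [hη.1, Real.pi_pos], hη.2⟩
  have hsin : 0 < Real.sin η := Real.sin_pos_of_pos_of_lt_pi hη.1 (by linarith [hη.2, Real.pi_pos])
  have hTA : c + r • dir (μ - η) - (c + (r / Real.cos η) • dir μ) =
      -((r * Real.sin η / Real.cos η) • (Complex.I * dir (μ - η))) := by
    rw [div_cos_smul_dir_eq_sub hcos.ne']; ring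
  have hSA : c + r • dir (μ + η) - (c + (r / Real.cos η) • dir μ) =
      (r * Real.sin η / Real.cos η) • (Complex.I * dir (μ + η)) := by
    rw [div_cos_smul_dir_eq_add hcos.ne']; ring
  have hk : r * Real.sin η / Real.cos η ≠ 0 := by positivity
  ext w
  constructor
  · rintro ⟨hw, d, h1, h2, -, h4⟩
    -- the two orthogonality conditions determine the centre
    have hd : d = c := by
      rw [hTA, inner_neg_right, neg_eq_zero, real_inner_smul_right, mul_eq_zero,
        or_iff_right hk, show c + r • dir (μ - η) - d = r • dir (μ - η) - (d - c) by ring,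
        inner_sub_left, real_inner_smul_left, inner_dir_I_mul_dir, sub_self, Real.sin_zero,
        mul_zero, zero_sub, neg_eq_zero] at h1
      rw [hSA, real_inner_smul_right, mul_eq_zero,
        or_iff_right hk, show c + r • dir (μ + η) - d = r • dir (μ + η) - (d - c) by ring,
        inner_sub_left, real_inner_smul_left, inner_dir_I_mul_dir, sub_self, Real.sin_zero,
        mul_zero, zero_sub, neg_eq_zero] at h2
      have h5 := eq_inner_dir_mul (d - c) (μ - η)
      rw [h1, Complex.ofReal_zero, zero_mul, add_zero, ← Complex.real_smul] at h5
      rw [h5, real_inner_smul_left, inner_dir_I_mul_dir, mul_eq_zero] at h2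
      have h6 : Real.sin (μ - η - (μ + η)) ≠ 0 := by
        rw [show μ - η - (μ + η) = -(2 * η) by ring, Real.sin_neg, neg_ne_zero, Real.sin_two_mul]
        positivity
      rw [or_iff_left h6] at h2
      rw [h2, zero_smul] at h5
      exact sub_eq_zero.1 h5
    subst hd
    have hwr : ‖w - d‖ = r := by
      rw [dist_eq_norm, dist_eq_norm, add_sub_cancel_left, norm_smul, norm_dir, mul_one,
        Real.norm_of_nonneg hr.le] at h4
      exact h4
    -- the triangle lies on the outer side of the chord
    have hchord : r * Real.cos η ≤ inner ℝ (w - d) (dir μ) := by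
      have hsub : convexHull ℝ {d + (r / Real.cos η) • dir μ, d + r • dir (μ - η),
          d + r • dir (μ + η)} ⊆
          {w | r * Real.cos η + inner ℝ d (dir μ) ≤ inner ℝ w (dir μ)} := by
        refine convexHull_min ?_ (convex_halfSpace_ge ⟨fun x y => inner_add_left x y _,
          fun a x => real_inner_smul_left x _ a⟩ _)
        have hle : r * Real.cos η ≤ r / Real.cos η := by
          rw [le_div_iff₀ hcos]
          nlinarith [Real.cos_le_one η, mul_pos hr hcos]
        rintro x (rfl | rfl | rfl) <;>
          simp only [mem_ofPred_eq, inner_add_left, real_inner_smul_left, inner_dir_dir]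
        · rw [sub_self, Real.cos_zero]; linarith
        · rw [sub_sub_cancel]; linarith
        · rw [show μ - (μ + η) = -η by ring, Real.cos_neg]; linarith
      have := hsub hw
      simp only [mem_ofPred_eq] at this
      rw [inner_sub_left]; linarith
    set q := (w - d) * dir (-μ) with hq
    have hqn : ‖q‖ = r := by rw [hq, norm_mul, norm_dir, mul_one, hwr]
    have hqd : q = r • dir q.arg := by
      rw [← hqn, Complex.real_smul, dir, Complex.norm_mul_exp_arg_mul_I]
    have hwd : w - d = r • dir (μ + q.arg) := by
      have h5 : dir (-μ) * dir μ = 1 := by rw [← dir_add, neg_add_cancel]; simp [dir]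
      calc w - d = q * dir μ := by rw [hq, mul_assoc, h5, mul_one]
        _ = r • dir (μ + q.arg) := by rw [hqd, smul_mul_assoc, ← dir_add, ← hqd, add_comm]
    rw [hwd, real_inner_smul_left, inner_dir_dir, show μ - (μ + q.arg) = -q.arg by ring,
      Real.cos_neg] at hchord
    have hcosle := le_of_mul_le_mul_left hchord hr
    have habs : |q.arg| ≤ η := by
      by_contra! h
      have := Real.cos_lt_cos_of_nonneg_of_le_pi hη.1.le (Complex.abs_arg_le_pi q) h
      rw [Real.cos_abs] at this
      linarith
    refine ⟨μ + q.arg, ⟨by linarith [neg_abs_le q.arg], by linarith [le_abs_self q.arg]⟩, ?_⟩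
    rw [Complex.real_smul] at hwd
    change d + r * dir (μ + q.arg) = w
    rw [← hwd]; ring
  · rintro ⟨s, hs, rfl⟩
    change c + r * dir s ∈ _
    rw [← Complex.real_smul]
    refine ⟨?_, c, ?_, ?_, ?_, ?_⟩
    · obtain ⟨t, rfl⟩ : ∃ t, s = μ + t := ⟨s - μ, by ring⟩
      have ht1 : -η ≤ t := by linarith [hs.1]
      have ht2 : t ≤ η := by linarith [hs.2]
      have hct : Real.cos η ≤ Real.cos t := by
        rw [← Real.cos_abs t]
        exact Real.cos_le_cos_of_nonneg_of_le_pi (abs_nonneg t) (by linarith [hη.2, Real.pi_pos])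
          (abs_le.2 ⟨ht1, ht2⟩)
      have e := Real.sin_sq_add_cos_sq η
      have hc1 : Real.cos t * Real.cos η - Real.sin t * Real.sin η ≤ 1 := by
        rw [← Real.cos_add]; exact Real.cos_le_one _
      have hc2 : Real.cos t * Real.cos η + Real.sin t * Real.sin η ≤ 1 := by
        rw [← Real.cos_sub]; exact Real.cos_le_one _
      have hs2 : 0 < Real.sin η ^ 2 := by positivity
      -- the barycentric coordinates of the point of the arc
      set a : ℝ := Real.cos η * (Real.cos t - Real.cos η) / Real.sin η ^ 2 with ha
      set b : ℝ := (1 - (Real.cos t * Real.cos η + Real.sin t * Real.sin η)) /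
        (2 * Real.sin η ^ 2) with hb
      set b' : ℝ := (1 - (Real.cos t * Real.cos η - Real.sin t * Real.sin η)) /
        (2 * Real.sin η ^ 2) with hb'
      have hsum : a + b + b' = 1 := by
        rw [ha, hb, hb']; field_simp; linear_combination -2 * e
      have hmem := combo_mem_convexHull_triple (A := c + (r / Real.cos η) • dir μ)
        (T := c + r • dir (μ - η)) (S := c + r • dir (μ + η)) (a := a) (b := b) (c := b')
        (div_nonneg (mul_nonneg hcos.le (by linarith)) hs2.le)
        (div_nonneg (by linarith) (by positivity))
        (div_nonneg (by linarith) (by positivity)) hsum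
      have hx : Real.cos t = a / Real.cos η + (b + b') * Real.cos η := by
        rw [show b + b' = 1 - a by linarith, ha]
        field_simp
        linear_combination (Real.cos t - Real.cos η) * e
      have hy : Real.sin t = (b' - b) * Real.sin η := by
        rw [hb, hb']; field_simp; ring
      convert hmem using 1
      rw [sub_eq_add_neg μ η, dir_add, dir_add, dir_add, dir_eq t, dir_eq η, dir_eq (-η),
        Real.cos_neg, Real.sin_neg, hx, hy]
      simp only [Complex.real_smul]
      have hsumc : (a : ℂ) + b + b' = 1 := by exact_mod_cast hsum
      push_cast
      linear_combination (-c) * hsumc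
    · rw [add_sub_cancel_left, hTA, inner_neg_right, real_inner_smul_right, real_inner_smul_left,
        inner_dir_I_mul_dir, sub_self, Real.sin_zero, mul_zero, mul_zero, neg_zero]
    · rw [add_sub_cancel_left, hSA, real_inner_smul_right, real_inner_smul_left,
        inner_dir_I_mul_dir, sub_self, Real.sin_zero, mul_zero, mul_zero]
    · simp [dist_eq_norm, norm_dir]
    · simp [dist_eq_norm, norm_dir]

/-! ### The rounded polygon as a chain of arcs -/

/-- The direction angle of the outer normal to the edge `A_n A_{n+1}`. -/
noncomputable def edgeAng (lam C : ℝ) (n : ℕ) : ℝ := (ang lam C n + ang lam C (n + 1)) / 2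

/-- Half of the angle under which the edge `A_n A_{n+1}` is seen from the origin. -/
noncomputable def edgeHalf (lam C : ℝ) (n : ℕ) : ℝ := (ang lam C n - ang lam C (n + 1)) / 2

/-- Half of the angle by which the normal turns at the corner `A_{n+1}`. -/
noncomputable def cornerHalf (lam C : ℝ) (n : ℕ) : ℝ :=
  (edgeAng lam C n - edgeAng lam C (n + 1)) / 2

/-- The radius of the arc that rounds off the corner `A_{n+1}`. -/
noncomputable def arcRad (lam C : ℝ) (n : ℕ) : ℝ :=
  Real.sin (edgeHalf lam C (n + 1)) * Real.cos (cornerHalf lam C n) /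
    Real.sin (cornerHalf lam C n)

/-- The centre of the arc that rounds off the corner `A_{n+1}`. -/
noncomputable def arcCen (lam C : ℝ) (n : ℕ) : ℂ :=
  (Real.cos (edgeHalf lam C (n + 1)) - arcRad lam C n) • dir (edgeAng lam C (n + 1))

section angles

variable {lam C : ℝ}

theorem ang_succ (n : ℕ) : ang lam C (n + 1) = ang lam C n * lam := by
  simp only [ang, pow_succ]; ring

theorem ang_pos (hlam : lam ∈ Ioo (0 : ℝ) 1) (hC : 0 < C) (n : ℕ) : 0 < ang lam C n :=
  mul_pos hC (pow_pos hlam.1 n)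

theorem ang_succ_lt (hlam : lam ∈ Ioo (0 : ℝ) 1) (hC : 0 < C) (n : ℕ) :
    ang lam C (n + 1) < ang lam C n := by
  rw [ang_succ]
  nlinarith [ang_pos hlam hC n, hlam.2]

theorem edgeAng_eq (n : ℕ) : edgeAng lam C n = ang lam C n * ((1 + lam) / 2) := by
  rw [edgeAng, ang_succ]; ring

theorem edgeHalf_eq (n : ℕ) : edgeHalf lam C n = ang lam C n * ((1 - lam) / 2) := by
  rw [edgeHalf, ang_succ]; ring

theorem cornerHalf_eq (n : ℕ) :
    cornerHalf lam C n = ang lam C n * ((1 - lam) * (1 + lam) / 4) := by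
  rw [cornerHalf, edgeAng_eq, edgeAng_eq, ang_succ]; ring

theorem ang_le_pi (hlam : lam ∈ Ioo (0 : ℝ) 1) (hC : 0 < C) (h1 : ang lam C 1 ≤ Real.pi) {n : ℕ}
    (hn : 1 ≤ n) : ang lam C n ≤ Real.pi :=
  (antitone_nat_of_succ_le (fun n => (ang_succ_lt hlam hC n).le) hn).trans h1

theorem ang_tendsto (hlam : lam ∈ Ioo (0 : ℝ) 1) : Tendsto (ang lam C) atTop (𝓝 0) := by
  have h := (tendsto_pow_atTop_nhds_zero_of_lt_one hlam.1.le hlam.2).const_mul C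
  rwa [mul_zero] at h

theorem edgeAng_mem (hlam : lam ∈ Ioo (0 : ℝ) 1) (hC : 0 < C) (h1 : ang lam C 1 ≤ Real.pi) {n : ℕ}
    (hn : 1 ≤ n) : edgeAng lam C n ∈ Ioo 0 Real.pi := by
  have := ang_pos hlam hC n
  have := ang_pos hlam hC (n + 1)
  have := ang_succ_lt hlam hC n
  have := ang_le_pi hlam hC h1 hn
  constructor <;> (rw [edgeAng]; linarith)

theorem edgeAng_succ_lt (hlam : lam ∈ Ioo (0 : ℝ) 1) (hC : 0 < C) (n : ℕ) :
    edgeAng lam C (n + 1) < edgeAng lam C n := by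
  have := ang_succ_lt hlam hC n
  have := ang_succ_lt hlam hC (n + 1)
  rw [edgeAng, edgeAng]; linarith

theorem edgeHalf_mem (hlam : lam ∈ Ioo (0 : ℝ) 1) (hC : 0 < C) (h1 : ang lam C 1 ≤ Real.pi) {n : ℕ}
    (hn : 1 ≤ n) : edgeHalf lam C n ∈ Ioo 0 (Real.pi / 2) := by
  have := ang_pos hlam hC (n + 1)
  have := ang_succ_lt hlam hC n
  have := ang_le_pi hlam hC h1 hn
  constructor <;> (rw [edgeHalf]; linarith)

theorem sin_edgeHalf_pos (hlam : lam ∈ Ioo (0 : ℝ) 1) (hC : 0 < C) (h1 : ang lam C 1 ≤ Real.pi)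
    {n : ℕ} (hn : 1 ≤ n) : 0 < Real.sin (edgeHalf lam C n) := by
  have := edgeHalf_mem hlam hC h1 hn
  exact Real.sin_pos_of_pos_of_lt_pi this.1 (by linarith [this.2, Real.pi_pos])

theorem sin_edgeHalf_succ_le (hlam : lam ∈ Ioo (0 : ℝ) 1) (hC : 0 < C) (h1 : ang lam C 1 ≤ Real.pi)
    {n : ℕ} (hn : 1 ≤ n) :
    Real.sin (edgeHalf lam C (n + 1)) ≤ Real.sin (edgeHalf lam C n) := by
  have h2 := edgeHalf_mem hlam hC h1 hn
  have h3 := edgeHalf_mem hlam hC h1 (Nat.le_succ_of_le hn)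
  refine Real.sin_le_sin_of_le_of_le_pi_div_two (by linarith [h3.1, Real.pi_pos]) h2.2.le ?_
  rw [edgeHalf_eq, edgeHalf_eq]
  exact mul_le_mul_of_nonneg_right (ang_succ_lt hlam hC n).le (by linarith [hlam.2])

theorem cornerHalf_mem (hlam : lam ∈ Ioo (0 : ℝ) 1) (hC : 0 < C) (h1 : ang lam C 1 ≤ Real.pi)
    {n : ℕ} (hn : 1 ≤ n) : cornerHalf lam C n ∈ Ioo 0 (Real.pi / 2) := by
  have h2 := edgeAng_mem hlam hC h1 hn
  have h3 := edgeAng_mem hlam hC h1 (Nat.le_succ_of_le hn)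
  have := edgeAng_succ_lt hlam hC n
  constructor <;> (rw [cornerHalf]; linarith [h2.2, h3.1])

theorem sin_cornerHalf_pos (hlam : lam ∈ Ioo (0 : ℝ) 1) (hC : 0 < C) (h1 : ang lam C 1 ≤ Real.pi)
    {n : ℕ} (hn : 1 ≤ n) : 0 < Real.sin (cornerHalf lam C n) := by
  have := cornerHalf_mem hlam hC h1 hn
  exact Real.sin_pos_of_pos_of_lt_pi this.1 (by linarith [this.2, Real.pi_pos])

theorem cos_cornerHalf_pos (hlam : lam ∈ Ioo (0 : ℝ) 1) (hC : 0 < C) (h1 : ang lam C 1 ≤ Real.pi)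
    {n : ℕ} (hn : 1 ≤ n) : 0 < Real.cos (cornerHalf lam C n) := by
  have := cornerHalf_mem hlam hC h1 hn
  exact Real.cos_pos_of_mem_Ioo ⟨by linarith [this.1, Real.pi_pos], this.2⟩

theorem arcRad_pos (hlam : lam ∈ Ioo (0 : ℝ) 1) (hC : 0 < C) (h1 : ang lam C 1 ≤ Real.pi)
    {n : ℕ} (hn : 1 ≤ n) : 0 < arcRad lam C n :=
  div_pos (mul_pos (sin_edgeHalf_pos hlam hC h1 (Nat.le_succ_of_le hn))
    (cos_cornerHalf_pos hlam hC h1 hn)) (sin_cornerHalf_pos hlam hC h1 hn)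

/-- The radii of the arcs `C_n` are bounded below. Both the length of an edge and the angle by which
the normal turns at its end are proportional to `λ^n`. -/
theorem arcRad_ge (hlam : lam ∈ Ioo (0 : ℝ) 1) (hC : 0 < C) (h1 : ang lam C 1 ≤ Real.pi)
    {n : ℕ} (hn : 1 ≤ n) :
    2 / Real.pi * (2 * lam / (1 + lam)) * Real.cos (cornerHalf lam C 1) ≤ arcRad lam C n := by
  have hl := hlam.1
  have hl' : 0 < 1 - lam := sub_pos.2 hlam.2
  have ha := ang_pos hlam hC n
  have hδ := edgeHalf_mem hlam hC h1 (Nat.le_succ_of_le hn)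
  have hη := cornerHalf_mem hlam hC h1 hn
  have h2 : 2 / Real.pi * edgeHalf lam C (n + 1) ≤ Real.sin (edgeHalf lam C (n + 1)) :=
    Real.mul_le_sin hδ.1.le hδ.2.le
  have h3 : Real.sin (cornerHalf lam C n) ≤ cornerHalf lam C n := Real.sin_le hη.1.le
  have h4 : Real.cos (cornerHalf lam C 1) ≤ Real.cos (cornerHalf lam C n) := by
    refine Real.cos_le_cos_of_nonneg_of_le_pi hη.1.le
      (by linarith [(cornerHalf_mem hlam hC h1 le_rfl).2, Real.pi_pos]) ?_
    rw [cornerHalf_eq, cornerHalf_eq]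
    exact mul_le_mul_of_nonneg_right
      (antitone_nat_of_succ_le (fun n => (ang_succ_lt hlam hC n).le) hn) (by positivity)
  have h5 : edgeHalf lam C (n + 1) = 2 * lam / (1 + lam) * cornerHalf lam C n := by
    rw [edgeHalf_eq, cornerHalf_eq, ang_succ]
    field_simp
    ring
  have hc := cos_cornerHalf_pos hlam hC h1 le_rfl
  rw [arcRad, le_div_iff₀ (sin_cornerHalf_pos hlam hC h1 hn)]
  have hpi := Real.pi_pos
  calc _ ≤ 2 / Real.pi * (2 * lam / (1 + lam)) * Real.cos (cornerHalf lam C 1) *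
        cornerHalf lam C n := by gcongr
    _ = 2 / Real.pi * edgeHalf lam C (n + 1) * Real.cos (cornerHalf lam C 1) := by rw [h5]; ring
    _ ≤ _ := mul_le_mul h2 h4 hc.le (sin_edgeHalf_pos hlam hC h1 (Nat.le_succ_of_le hn)).le

end angles

section vertices

variable (lam C : ℝ)

theorem vertex_eq (n : ℕ) : vertex lam C n = Real.cos (edgeHalf lam C n) • dir (edgeAng lam C n) +
    Real.sin (edgeHalf lam C n) • (Complex.I * dir (edgeAng lam C n)) := by
  have h : vertex lam C n = dir (edgeAng lam C n + edgeHalf lam C n) := by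
    rw [vertex, dir, edgeAng, edgeHalf]; congr 3; ring
  rw [h, dir_add, dir_eq (edgeHalf lam C n)]
  simp only [Complex.real_smul]; ring

theorem vertex_succ_eq (n : ℕ) :
    vertex lam C (n + 1) = Real.cos (edgeHalf lam C n) • dir (edgeAng lam C n) -
      Real.sin (edgeHalf lam C n) • (Complex.I * dir (edgeAng lam C n)) := by
  have h : vertex lam C (n + 1) = dir (edgeAng lam C n + -edgeHalf lam C n) := by
    rw [vertex, dir, edgeAng, edgeHalf]; congr 3; ring
  rw [h, dir_add, dir_eq (-edgeHalf lam C n), Real.cos_neg, Real.sin_neg]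
  simp only [Complex.real_smul]; push_cast; ring

theorem ptT_eq (n : ℕ) : ptT lam C n = Real.cos (edgeHalf lam C n) • dir (edgeAng lam C n) := by
  rw [ptT, midpoint_eq_smul_add, vertex_succ_eq, vertex_eq, invOf_eq_inv]
  module

variable {lam C}

theorem dist_ptT_vertex (hlam : lam ∈ Ioo (0 : ℝ) 1) (hC : 0 < C) (h1 : ang lam C 1 ≤ Real.pi)
    {n : ℕ} (hn : 1 ≤ n) : dist (ptT lam C n) (vertex lam C n) = Real.sin (edgeHalf lam C n) := by
  rw [dist_comm, dist_eq_norm, ptT_eq, vertex_eq, add_sub_cancel_left, norm_smul, norm_mul,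
    Complex.norm_I, norm_dir, one_mul, mul_one,
    Real.norm_of_nonneg (sin_edgeHalf_pos hlam hC h1 hn).le]

theorem ptS_succ_eq (hlam : lam ∈ Ioo (0 : ℝ) 1) (hC : 0 < C) (h1 : ang lam C 1 ≤ Real.pi)
    {n : ℕ} (hn : 1 ≤ n) : ptS lam C (n + 1) = Real.cos (edgeHalf lam C n) • dir (edgeAng lam C n) -
      (Real.sin (edgeHalf lam C n) - Real.sin (edgeHalf lam C (n + 1))) •
        (Complex.I * dir (edgeAng lam C n)) := by
  have hs := sin_edgeHalf_pos hlam hC h1 hn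
  have hd : dist (vertex lam C n) (vertex lam C (n + 1)) = 2 * Real.sin (edgeHalf lam C n) := by
    rw [dist_eq_norm, vertex_eq, vertex_succ_eq, add_sub_sub_cancel, ← two_smul ℝ, smul_smul,
      norm_smul (2 * _), norm_mul Complex.I, Complex.norm_I, norm_dir, one_mul, mul_one,
      Real.norm_of_nonneg (by positivity)]
  rw [ptS, Nat.add_sub_cancel, dist_ptT_vertex hlam hC h1 (n := n + 1) (by omega), hd,
    AffineMap.lineMap_apply, vsub_eq_sub, vadd_eq_add, vertex_succ_eq, vertex_eq,
    add_sub_sub_cancel]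
  match_scalars
  · field_simp; ring
  · ring

theorem arcCen_add_start (n : ℕ) : arcCen lam C n + arcRad lam C n • dir (edgeAng lam C (n + 1)) =
    Real.cos (edgeHalf lam C (n + 1)) • dir (edgeAng lam C (n + 1)) := by
  rw [arcCen]; module

theorem arcCen_add_apex (hlam : lam ∈ Ioo (0 : ℝ) 1) (hC : 0 < C) (h1 : ang lam C 1 ≤ Real.pi)
    {n : ℕ} (hn : 1 ≤ n) : arcCen lam C n + (arcRad lam C n / Real.cos (cornerHalf lam C n)) •
      dir ((edgeAng lam C n + edgeAng lam C (n + 1)) / 2) = vertex lam C (n + 1) := by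
  have hc := cos_cornerHalf_pos hlam hC h1 hn
  have hs := sin_cornerHalf_pos hlam hC h1 hn
  rw [div_cos_smul_dir_eq_sub hc.ne', ← add_assoc,
    show (edgeAng lam C n + edgeAng lam C (n + 1)) / 2 - cornerHalf lam C n =
      edgeAng lam C (n + 1) by rw [cornerHalf]; ring, arcCen_add_start, vertex_eq]
  congr 2
  rw [arcRad]
  field_simp

theorem arcCen_add_end (hlam : lam ∈ Ioo (0 : ℝ) 1) (hC : 0 < C) (h1 : ang lam C 1 ≤ Real.pi)
    {n : ℕ} (hn : 1 ≤ n) : arcCen lam C n + arcRad lam C n • dir (edgeAng lam C n) =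
      Real.cos (edgeHalf lam C n) • dir (edgeAng lam C n) -
      (Real.sin (edgeHalf lam C n) - Real.sin (edgeHalf lam C (n + 1))) •
        (Complex.I * dir (edgeAng lam C n)) := by
  have hc := cos_cornerHalf_pos hlam hC h1 hn
  have hs := sin_cornerHalf_pos hlam hC h1 hn
  have h := arcCen_add_apex hlam hC h1 hn
  rw [div_cos_smul_dir_eq_add hc.ne',
    show (edgeAng lam C n + edgeAng lam C (n + 1)) / 2 + cornerHalf lam C n =
      edgeAng lam C n by rw [cornerHalf]; ring, vertex_succ_eq] at h
  have h2 : arcRad lam C n * Real.sin (cornerHalf lam C n) / Real.cos (cornerHalf lam C n) =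
      Real.sin (edgeHalf lam C (n + 1)) := by rw [arcRad]; field_simp
  rw [h2] at h
  rw [sub_smul]
  linear_combination h

theorem roundArc_succ_eq (hlam : lam ∈ Ioo (0 : ℝ) 1) (hC : 0 < C) (h1 : ang lam C 1 ≤ Real.pi)
    {n : ℕ} (hn : 1 ≤ n) : roundArc lam C (n + 1) =
      circArc (arcCen lam C n) (arcRad lam C n) (edgeAng lam C (n + 1)) (edgeAng lam C n) := by
  have e1 : (edgeAng lam C n + edgeAng lam C (n + 1)) / 2 - cornerHalf lam C n =
      edgeAng lam C (n + 1) := by rw [cornerHalf]; ring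
  have e2 : (edgeAng lam C n + edgeAng lam C (n + 1)) / 2 + cornerHalf lam C n =
      edgeAng lam C n := by rw [cornerHalf]; ring
  have h := tangentArc_eq_circArc (arcCen lam C n)
    (μ := (edgeAng lam C n + edgeAng lam C (n + 1)) / 2) (arcRad_pos hlam hC h1 hn)
    (cornerHalf_mem hlam hC h1 hn)
  rw [e1, e2, arcCen_add_apex hlam hC h1 hn, arcCen_add_start, ← ptT_eq,
    arcCen_add_end hlam hC h1 hn, ← ptS_succ_eq hlam hC h1 hn] at h
  exact h

end vertices

section first

variable {lam C τ : ℝ}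

theorem firstPt_eq (lam C τ : ℝ) :
    firstPt lam C τ = Real.cos (edgeHalf lam C 1) • dir (edgeAng lam C 1) +
      ((1 - 2 * τ) * Real.sin (edgeHalf lam C 1)) • (Complex.I * dir (edgeAng lam C 1)) := by
  rw [firstPt, AffineMap.lineMap_apply, vsub_eq_sub, vadd_eq_add, vertex_succ_eq, vertex_eq]
  module

theorem inner_combo_dir (a b θ : ℝ) :
    inner ℝ (a • dir θ + b • (Complex.I * dir θ)) (dir θ) = a := by
  rw [inner_add_left, real_inner_smul_left, real_inner_smul_left, inner_dir_dir,
    inner_I_mul_dir_dir, sub_self, Real.cos_zero, Real.sin_zero, mul_one, mul_zero, add_zero]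

theorem norm_combo_sq (a b θ : ℝ) :
    ‖a • dir θ + b • (Complex.I * dir θ)‖ ^ 2 = a ^ 2 + b ^ 2 := by
  have h : a • dir θ + b • (Complex.I * dir θ) = (a + b * Complex.I) * dir θ := by
    simp only [Complex.real_smul]; ring
  rw [h, norm_mul, norm_dir, mul_one, ← Complex.normSq_eq_norm_sq, Complex.normSq_add_mul_I]

theorem cos_edgeHalf_lt_one (hlam : lam ∈ Ioo (0 : ℝ) 1) (hC : 0 < C) (h1 : ang lam C 1 ≤ Real.pi) :
    Real.cos (edgeHalf lam C 1) < 1 := by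
  have h := sin_edgeHalf_pos hlam hC h1 le_rfl
  nlinarith [Real.sin_sq_add_cos_sq (edgeHalf lam C 1), Real.cos_le_one (edgeHalf lam C 1)]

/-- The defining quotient of `firstRadius` simplifies by
`1 - |P|² = 4 τ (1 - τ) sin² δ`, where `δ` is half of the angle of the edge `A_1 A_2`. -/
theorem firstRadius_eq (hlam : lam ∈ Ioo (0 : ℝ) 1) (hC : 0 < C) (h1 : ang lam C 1 ≤ Real.pi)
    (τ : ℝ) : firstRadius lam C τ = 2 * τ * (1 - τ) * (1 + Real.cos (edgeHalf lam C 1)) := by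
  have hc := cos_edgeHalf_lt_one hlam hC h1
  have hd : Complex.exp (firstAng lam C * Complex.I) = dir (edgeAng lam C 1) := rfl
  rw [firstRadius, hd, firstPt_eq, norm_combo_sq, inner_combo_dir, div_eq_iff (by linarith)]
  linear_combination (-(1 - 2 * τ) ^ 2) * Real.sin_sq_add_cos_sq (edgeHalf lam C 1)

theorem firstRadius_mem (hlam : lam ∈ Ioo (0 : ℝ) 1) (hC : 0 < C) (h1 : ang lam C 1 ≤ Real.pi)
    (hτ : τ ∈ Icc (0 : ℝ) (1 / 2)) : firstRadius lam C τ ∈ Ico 0 1 := by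
  have hc := cos_edgeHalf_lt_one hlam hC h1
  have hc' := Real.neg_one_le_cos (edgeHalf lam C 1)
  rw [firstRadius_eq hlam hC h1]
  have h2 : 0 ≤ τ * (1 - τ) := mul_nonneg hτ.1 (by linarith [hτ.2])
  have h3 : τ * (1 - τ) ≤ 1 / 4 := by nlinarith [sq_nonneg (1 - 2 * τ)]
  constructor
  · have := mul_nonneg h2 (by linarith : 0 ≤ 1 + Real.cos (edgeHalf lam C 1))
    nlinarith
  · have := mul_le_mul_of_nonneg_right h3 (by linarith : 0 ≤ 1 + Real.cos (edgeHalf lam C 1))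
    nlinarith

theorem firstRadius_pos (hlam : lam ∈ Ioo (0 : ℝ) 1) (hC : 0 < C) (h1 : ang lam C 1 ≤ Real.pi)
    (hτ : τ ∈ Icc (0 : ℝ) (1 / 2)) (hτ0 : 0 < τ) : 0 < firstRadius lam C τ := by
  have hδ := edgeHalf_mem hlam hC h1 le_rfl
  have hc : 0 < Real.cos (edgeHalf lam C 1) :=
    Real.cos_pos_of_mem_Ioo ⟨by linarith [hδ.1, Real.pi_pos], hδ.2⟩
  have : 0 < 1 - τ := by linarith [hτ.2]
  rw [firstRadius_eq hlam hC h1]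
  positivity

theorem firstCenter_eq (lam C τ : ℝ) : firstCenter lam C τ =
    (Real.cos (edgeHalf lam C 1) - firstRadius lam C τ) • dir (edgeAng lam C 1) +
      ((1 - 2 * τ) * Real.sin (edgeHalf lam C 1)) • (Complex.I * dir (edgeAng lam C 1)) := by
  have hd : Complex.exp (firstAng lam C * Complex.I) = dir (edgeAng lam C 1) := rfl
  rw [firstCenter, hd, ← Complex.real_smul, firstPt_eq]
  module

theorem norm_firstCenter (hlam : lam ∈ Ioo (0 : ℝ) 1) (hC : 0 < C) (h1 : ang lam C 1 ≤ Real.pi)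
    (hτ : τ ∈ Icc (0 : ℝ) (1 / 2)) : ‖firstCenter lam C τ‖ = 1 - firstRadius lam C τ := by
  have hρ := firstRadius_mem hlam hC h1 hτ
  rw [← sq_eq_sq₀ (norm_nonneg _) (by linarith [hρ.2]), firstCenter_eq, norm_combo_sq,
    firstRadius_eq hlam hC h1]
  linear_combination (1 - 2 * τ) ^ 2 * Real.sin_sq_add_cos_sq (edgeHalf lam C 1)

theorem firstCenter_mul_exp (lam C τ : ℝ) :
    firstCenter lam C τ * Complex.exp (-(firstAng lam C * Complex.I)) =
      (Real.cos (edgeHalf lam C 1) - firstRadius lam C τ : ℝ) +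
        ((1 - 2 * τ) * Real.sin (edgeHalf lam C 1) : ℝ) * Complex.I := by
  have hd : Complex.exp (-(firstAng lam C * Complex.I)) = (dir (edgeAng lam C 1))⁻¹ :=
    Complex.exp_neg _
  rw [hd, firstCenter_eq, mul_inv_eq_iff_eq_mul₀ (dir_ne_zero _)]
  simp only [Complex.real_smul]
  ring

theorem firstEnd_mem (hlam : lam ∈ Ioo (0 : ℝ) 1) (hC : 0 < C) (h1 : ang lam C 1 ≤ Real.pi)
    (hτ : τ ∈ Icc (0 : ℝ) (1 / 2)) :
    firstEnd lam C τ ∈ Icc (edgeAng lam C 1) (edgeAng lam C 1 + Real.pi) := by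
  have h0 : firstEnd lam C τ = edgeAng lam C 1 + Complex.arg
    (firstCenter lam C τ * Complex.exp (-(firstAng lam C * Complex.I))) := rfl
  have h2 : 0 ≤ Complex.arg
      (firstCenter lam C τ * Complex.exp (-(firstAng lam C * Complex.I))) := by
    rw [Complex.arg_nonneg_iff, firstCenter_mul_exp]
    simp only [Complex.add_im, Complex.ofReal_im, Complex.mul_im, Complex.ofReal_re, Complex.I_im,
      Complex.I_re, mul_one, mul_zero, add_zero, zero_add]
    exact mul_nonneg (by linarith [hτ.2]) (sin_edgeHalf_pos hlam hC h1 le_rfl).le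
  rw [h0]
  constructor
  · linarith
  · linarith [Complex.arg_le_pi
      (firstCenter lam C τ * Complex.exp (-(firstAng lam C * Complex.I)))]

theorem firstEnd_lt (hlam : lam ∈ Ioo (0 : ℝ) 1) (hC : 0 < C) (h1 : ang lam C 1 ≤ Real.pi)
    (hτ : τ ∈ Icc (0 : ℝ) (1 / 2)) : firstEnd lam C τ < 2 * Real.pi := by
  linarith [(firstEnd_mem hlam hC h1 hτ).2, (edgeAng_mem hlam hC h1 le_rfl).2]

theorem firstCenter_eq_smul_dir (hlam : lam ∈ Ioo (0 : ℝ) 1) (hC : 0 < C)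
    (h1 : ang lam C 1 ≤ Real.pi) (hτ : τ ∈ Icc (0 : ℝ) (1 / 2)) :
    firstCenter lam C τ = (1 - firstRadius lam C τ) • dir (firstEnd lam C τ) := by
  have h0 : firstEnd lam C τ = edgeAng lam C 1 + Complex.arg
    (firstCenter lam C τ * Complex.exp (-(firstAng lam C * Complex.I))) := rfl
  set q := firstCenter lam C τ * Complex.exp (-(firstAng lam C * Complex.I)) with hq
  have hd : Complex.exp (-(firstAng lam C * Complex.I)) = (dir (edgeAng lam C 1))⁻¹ :=
    Complex.exp_neg _
  have hqn : ‖q‖ = 1 - firstRadius lam C τ := by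
    rw [hq, hd, norm_mul, norm_inv, norm_dir, inv_one, mul_one, norm_firstCenter hlam hC h1 hτ]
  have h2 : ‖q‖ • dir q.arg = q := by
    rw [Complex.real_smul, dir, Complex.norm_mul_exp_arg_mul_I]
  rw [h0, dir_add, mul_comm, ← smul_mul_assoc, ← hqn, h2, hq, hd,
    inv_mul_cancel_right₀ (dir_ne_zero _)]

end first

/-- The angles at which the arcs of the rounded polygon meet: `2π`, the end of the arc `B`, and
the directions of the normals to the edges. -/
noncomputable def chainAng (lam C τ : ℝ) : ℕ → ℝ
  | 0 => 2 * Real.pi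
  | 1 => firstEnd lam C τ
  | k + 2 => edgeAng lam C (k + 1)

/-- The centres of the arcs of the rounded polygon: `D`, `B`, `C_2`, `C_3`, … -/
noncomputable def chainCen (lam C τ : ℝ) : ℕ → ℂ
  | 0 => 0
  | 1 => firstCenter lam C τ
  | k + 2 => arcCen lam C (k + 1)

/-- The radii of the arcs of the rounded polygon: `D`, `B`, `C_2`, `C_3`, … -/
noncomputable def chainRad (lam C τ : ℝ) : ℕ → ℝ
  | 0 => 1
  | 1 => firstRadius lam C τ
  | k + 2 => arcRad lam C (k + 1)

section chain

variable {lam C τ : ℝ}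

/-- The rounded polygon is a closed chain of arcs, and remains one if all radii are diminished by a
constant not exceeding them. -/
theorem closedArcChain_sub (hlam : lam ∈ Ioo (0 : ℝ) 1) (hC : 0 < C) (h1 : ang lam C 1 ≤ Real.pi)
    (hτ : τ ∈ Icc (0 : ℝ) (1 / 2)) {r : ℝ} (hr : ∀ n, r ≤ chainRad lam C τ n) :
    ClosedArcChain (chainAng lam C τ) (chainCen lam C τ) fun n => chainRad lam C τ n - r where
  anti := by
    refine antitone_nat_of_succ_le fun n => ?_
    match n with
    | 0 => exact (firstEnd_lt hlam hC h1 hτ).le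
    | 1 => exact (firstEnd_mem hlam hC h1 hτ).1
    | k + 2 => exact (edgeAng_succ_lt hlam hC (k + 1)).le
  nonneg n := sub_nonneg.2 (hr n)
  gap n := by
    match n with
    | 0 =>
      refine ⟨0, le_rfl, ?_⟩
      simp only [chainCen, chainRad, chainAng, zero_add, zero_smul, add_zero]
      rw [firstCenter_eq_smul_dir hlam hC h1 hτ]
      module
    | 1 =>
      refine ⟨(2 - 2 * τ) * Real.sin (edgeHalf lam C 1) - Real.sin (edgeHalf lam C 2), ?_, ?_⟩
      · have h2 := sin_edgeHalf_succ_le hlam hC h1 (le_refl 1)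
        have h3 := sin_edgeHalf_pos hlam hC h1 (le_refl 1)
        nlinarith [hτ.2]
      · have h2 := arcCen_add_end hlam hC h1 (le_refl 1)
        simp only [chainCen, chainRad, chainAng, zero_add]
        rw [sub_smul (arcRad lam C 1), ← add_sub_assoc, h2, firstCenter_eq]
        module
    | k + 2 =>
      refine ⟨Real.sin (edgeHalf lam C (k + 2)) - Real.sin (edgeHalf lam C (k + 3)),
        sub_nonneg.2 (sin_edgeHalf_succ_le hlam hC h1 (by omega)), ?_⟩
      have h2 := arcCen_add_end hlam hC h1 (n := k + 2) (by omega)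
      have h3 := arcCen_add_start (lam := lam) (C := C) (k + 1)
      simp only [chainCen, chainRad, chainAng]
      rw [sub_smul, sub_smul, ← add_sub_assoc, ← add_sub_assoc, h2, h3]
      module
  start := rfl
  angle_tendsto := by
    rw [← tendsto_add_atTop_iff_nat 2]
    have h := ((ang_tendsto (C := C) hlam).comp (tendsto_add_atTop_nat 1)).mul_const ((1 + lam) / 2)
    rw [zero_mul] at h
    exact h.congr fun k => (edgeAng_eq (k + 1)).symm
  tendsto := by
    rw [← tendsto_add_atTop_iff_nat 2]
    have hA := (ang_tendsto (C := C) hlam).comp (tendsto_add_atTop_nat 2)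
    have h2 : Tendsto (fun x : ℝ => (Real.cos (x * ((1 - lam) / 2)) - r) •
        dir (x * ((1 + lam) / 2))) (𝓝 0) (𝓝 ((1 - r) • (1 : ℂ))) := by
      have hc : Continuous fun x : ℝ => (Real.cos (x * ((1 - lam) / 2)) - r) •
          dir (x * ((1 + lam) / 2)) := by
        have := continuous_dir
        fun_prop
      have h3 := hc.tendsto 0
      simpa [dir] using h3
    have h3 : (0 : ℂ) + (1 - r) • dir (2 * Real.pi) = (1 - r) • (1 : ℂ) := by
      rw [zero_add]
      congr 1
      rw [← zero_add (2 * Real.pi), dir_add_two_pi]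
      simp [dir]
    simp only [chainCen, chainRad, chainAng]
    rw [h3]
    refine (h2.comp hA).congr fun k => ?_
    simp only [Function.comp]
    rw [← edgeHalf_eq, ← edgeAng_eq, sub_smul, sub_smul, ← add_sub_assoc, arcCen_add_start]

theorem chainRad_nonneg (hlam : lam ∈ Ioo (0 : ℝ) 1) (hC : 0 < C) (h1 : ang lam C 1 ≤ Real.pi)
    (hτ : τ ∈ Icc (0 : ℝ) (1 / 2)) (n : ℕ) : 0 ≤ chainRad lam C τ n := by
  match n with
  | 0 => exact zero_le_one
  | 1 => exact (firstRadius_mem hlam hC h1 hτ).1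
  | k + 2 => exact (arcRad_pos hlam hC h1 (by omega)).le

theorem closedArcChain (hlam : lam ∈ Ioo (0 : ℝ) 1) (hC : 0 < C) (h1 : ang lam C 1 ≤ Real.pi)
    (hτ : τ ∈ Icc (0 : ℝ) (1 / 2)) :
    ClosedArcChain (chainAng lam C τ) (chainCen lam C τ) (chainRad lam C τ) := by
  simpa using closedArcChain_sub hlam hC h1 hτ (chainRad_nonneg hlam hC h1 hτ)

theorem exists_le_chainRad (hlam : lam ∈ Ioo (0 : ℝ) 1) (hC : 0 < C) (h1 : ang lam C 1 ≤ Real.pi)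
    (hτ : τ ∈ Icc (0 : ℝ) (1 / 2)) (hτ0 : 0 < τ) : ∃ r > 0, ∀ n, r ≤ chainRad lam C τ n := by
  have hρ := firstRadius_pos hlam hC h1 hτ hτ0
  have hρ1 := (firstRadius_mem hlam hC h1 hτ).2
  have hc := cos_cornerHalf_pos hlam hC h1 (le_refl 1)
  have hl := hlam.1
  have hpi := Real.pi_pos
  refine ⟨min (firstRadius lam C τ)
    (2 / Real.pi * (2 * lam / (1 + lam)) * Real.cos (cornerHalf lam C 1)), by positivity,
    fun n => ?_⟩
  match n with
  | 0 => exact (min_le_left _ _).trans hρ1.le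
  | 1 => exact min_le_left _ _
  | k + 2 => exact (min_le_right _ _).trans (arcRad_ge hlam hC h1 (by omega))

theorem body_eq (hlam : lam ∈ Ioo (0 : ℝ) 1) (hC : 0 < C) (h1 : ang lam C 1 ≤ Real.pi) (τ : ℝ) :
    body lam C τ =
      convexHull ℝ (chainArcs (chainAng lam C τ) (chainCen lam C τ) (chainRad lam C τ)) := by
  rw [body]
  congr 1
  have hB : circArc (firstCenter lam C τ) (firstRadius lam C τ) (firstAng lam C)
      (firstEnd lam C τ) = circArc (chainCen lam C τ 1) (chainRad lam C τ 1)
        (chainAng lam C τ (1 + 1)) (chainAng lam C τ 1) := rfl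
  have hR : ∀ k, roundArc lam C (k + 2) = circArc (chainCen lam C τ (k + 2))
      (chainRad lam C τ (k + 2)) (chainAng lam C τ (k + 2 + 1)) (chainAng lam C τ (k + 2)) :=
    fun k => roundArc_succ_eq hlam hC h1 (by omega)
  apply Subset.antisymm
  · refine union_subset (union_subset ?_ ?_) ?_
    · refine iUnion₂_subset fun n hn => ?_
      obtain ⟨k, rfl⟩ := Nat.exists_eq_add_of_le' hn
      rw [hR]
      exact subset_iUnion_of_subset (k + 2) le_rfl
    · exact subset_iUnion_of_subset 1 le_rfl
    · exact subset_iUnion_of_subset 0 le_rfl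
  · refine iUnion_subset fun n => ?_
    match n with
    | 0 => exact subset_union_right
    | 1 => exact subset_union_right.trans subset_union_left
    | k + 2 =>
      rw [← hR]
      exact fun x hx => Or.inl (Or.inl (mem_iUnion₂.2 ⟨k + 2, Nat.le_add_left 2 k, hx⟩))

end chain

/-! ### Compactness -/

/-- In finite dimension, the convex hull of a compact set is compact, by Carathéodory's theorem. -/
theorem isCompact_convexHull {E : Type*} [NormedAddCommGroup E] [NormedSpace ℝ E]
    [FiniteDimensional ℝ E] {s : Set E} (hs : IsCompact s) : IsCompact (convexHull ℝ s) := by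
  have h : convexHull ℝ s = ⋃ k ∈ Finset.range (Module.finrank ℝ E + 2),
      (fun p : (Fin k → ℝ) × (Fin k → E) => ∑ i, p.1 i • p.2 i) ''
        (stdSimplex ℝ (Fin k) ×ˢ univ.pi fun _ => s) := by
    apply Subset.antisymm
    · intro x hx
      obtain ⟨ι, _, z, w, hz, hind, hw, hw1, hwx⟩ := eq_pos_convex_span_of_mem_convexHull hx
      have hcard : Fintype.card ι ≤ Module.finrank ℝ E + 1 :=
        hind.card_le_finrank_succ.trans (Nat.succ_le_succ (Submodule.finrank_le _))
      let e := Fintype.equivFin ι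
      refine mem_iUnion₂.2 ⟨Fintype.card ι, Finset.mem_range.2 (by omega),
        (w ∘ e.symm, z ∘ e.symm), ⟨⟨fun i => (hw _).le, ?_⟩, fun i _ => hz (mem_range_self _)⟩, ?_⟩
      · simpa using (e.symm.sum_comp w).trans hw1
      · simpa using (e.symm.sum_comp fun i => w i • z i).trans hwx
    · refine iUnion₂_subset fun k _ => ?_
      rintro _ ⟨⟨w, z⟩, ⟨hw, hz⟩, rfl⟩
      exact (convex_convexHull ℝ s).sum_mem (fun i _ => hw.1 i) hw.2
        fun i _ => subset_convexHull ℝ s (hz i (mem_univ i))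
  rw [h]
  refine (Finset.range _).isCompact_biUnion fun k _ => ?_
  refine ((isCompact_stdSimplex ℝ (Fin k)).prod (isCompact_univ_pi fun _ => hs)).image ?_
  fun_prop

/-- A sequence of compact sets that converges to a point of its union has a compact union. -/
theorem isCompact_iUnion_of_subset_ball {X : Type*} [PseudoMetricSpace X] {S : ℕ → Set X}
    (hS : ∀ n, IsCompact (S n)) {x : X} (hx : x ∈ ⋃ n, S n)
    (hlim : ∀ ε > 0, ∀ᶠ n in atTop, S n ⊆ Metric.ball x ε) : IsCompact (⋃ n, S n) := by
  rw [isCompact_iff_ultrafilter_le_nhds']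
  intro f hf
  by_cases h : ∀ ε > 0, Metric.ball x ε ∈ f
  · exact ⟨x, hx, Metric.nhds_basis_ball.ge_iff.2 h⟩
  · push Not at h
    obtain ⟨ε, hε, hεf⟩ := h
    obtain ⟨N, hN⟩ := eventually_atTop.1 (hlim ε hε)
    have hfin : IsCompact (⋃ n ∈ Finset.range N, S n) :=
      (Finset.range N).isCompact_biUnion fun n _ => hS n
    have hmem : (⋃ n ∈ Finset.range N, S n) ∈ f := by
      filter_upwards [hf, Ultrafilter.compl_mem_iff_notMem.2 hεf] with y hy hyb
      obtain ⟨n, hn⟩ := mem_iUnion.1 hy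
      refine mem_iUnion₂.2 ⟨n, Finset.mem_range.2 (not_le.1 fun hNn => hyb (hN n hNn hn)), hn⟩
    obtain ⟨y, hy, hfy⟩ := isCompact_iff_ultrafilter_le_nhds'.1 hfin f hmem
    obtain ⟨n, -, hn⟩ := mem_iUnion₂.1 hy
    exact ⟨y, mem_iUnion.2 ⟨n, hn⟩, hfy⟩

theorem isCompact_circArc (c : ℂ) (r a b : ℝ) : IsCompact (circArc c r a b) :=
  isCompact_Icc.image (by fun_prop)

theorem dir_two_pi : dir (2 * Real.pi) = 1 := by
  rw [← zero_add (2 * Real.pi), dir_add_two_pi]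
  simp [dir]

/-! ### The rounded polygon is a convex body -/

section body

variable {lam C τ : ℝ}

theorem arc_subset_body (hlam : lam ∈ Ioo (0 : ℝ) 1) (hC : 0 < C) (h1 : ang lam C 1 ≤ Real.pi)
    {n : ℕ} {s : ℝ} (hs : s ∈ Icc (chainAng lam C τ (n + 1)) (chainAng lam C τ n)) :
    chainCen lam C τ n + chainRad lam C τ n • dir s ∈ body lam C τ := by
  rw [body_eq hlam hC h1]
  exact subset_convexHull ℝ _ (mem_chainArcs.2 ⟨n, s, hs, rfl⟩)

theorem one_mem_arc (hlam : lam ∈ Ioo (0 : ℝ) 1) (hC : 0 < C) (h1 : ang lam C 1 ≤ Real.pi)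
    (hτ : τ ∈ Icc (0 : ℝ) (1 / 2)) : (1 : ℂ) ∈ circArc 0 1 (firstEnd lam C τ) (2 * Real.pi) :=
  ⟨2 * Real.pi, ⟨(firstEnd_lt hlam hC h1 hτ).le, le_rfl⟩, by
    have := dir_two_pi
    rw [dir] at this
    simp only [this]; simp⟩

theorem roundArc_subset_closedBall (hlam : lam ∈ Ioo (0 : ℝ) 1) (hC : 0 < C)
    (h1 : ang lam C 1 ≤ Real.pi) {n : ℕ} (hn : 1 ≤ n) : roundArc lam C (n + 1) ⊆
      Metric.closedBall (vertex lam C (n + 1)) (Real.sin (edgeHalf lam C (n + 1))) := by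
  have hs := sin_edgeHalf_pos hlam hC h1 (n := n + 1) (by omega)
  rintro w ⟨hw, -⟩
  refine convexHull_min ?_ (convex_closedBall _ _) hw
  rintro x (rfl | rfl | rfl)
  · exact Metric.mem_closedBall_self hs.le
  · exact (dist_ptT_vertex hlam hC h1 (by omega)).le
  · rw [Metric.mem_closedBall, ptS_succ_eq hlam hC h1 hn, vertex_succ_eq, dist_eq_norm,
      sub_smul, sub_sub_sub_cancel_left, sub_sub_cancel, norm_smul, norm_mul, Complex.norm_I,
      norm_dir, one_mul, mul_one, Real.norm_of_nonneg hs.le]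

theorem isCompact_body (hlam : lam ∈ Ioo (0 : ℝ) 1) (hC : 0 < C) (h1 : ang lam C 1 ≤ Real.pi)
    (hτ : τ ∈ Icc (0 : ℝ) (1 / 2)) : IsCompact (body lam C τ) := by
  rw [body_eq hlam hC h1]
  refine isCompact_convexHull (isCompact_iUnion_of_subset_ball (fun n => isCompact_circArc _ _ _ _)
    (x := 1) (mem_iUnion.2 ⟨0, one_mem_arc hlam hC h1 hτ⟩) fun ε hε => ?_)
  have hv : Tendsto (fun n => vertex lam C n) atTop (𝓝 1) := by
    have := (continuous_dir.tendsto 0).comp (ang_tendsto (C := C) hlam)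
    simpa [dir, vertex, Function.comp_def] using this
  have hs : Tendsto (fun n => Real.sin (edgeHalf lam C n)) atTop (𝓝 0) := by
    have h2 : Tendsto (fun n => edgeHalf lam C n) atTop (𝓝 0) := by
      have := (ang_tendsto (C := C) hlam).mul_const ((1 - lam) / 2)
      rw [zero_mul] at this
      exact this.congr fun n => (edgeHalf_eq n).symm
    have := (Real.continuous_sin.tendsto 0).comp h2
    rwa [Real.sin_zero] at this
  have hv' := hv.eventually (Metric.ball_mem_nhds 1 (half_pos hε))
  have hs' := hs.eventually (gt_mem_nhds (half_pos hε))
  filter_upwards [hv', hs', eventually_ge_atTop 2] with n hvn hsn hn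
  obtain ⟨k, rfl⟩ := Nat.exists_eq_add_of_le' hn
  have hR : circArc (chainCen lam C τ (k + 2)) (chainRad lam C τ (k + 2))
      (chainAng lam C τ (k + 2 + 1)) (chainAng lam C τ (k + 2)) = roundArc lam C (k + 2) :=
    (roundArc_succ_eq hlam hC h1 (by omega)).symm
  rw [hR]
  intro w hw
  have h2 := roundArc_subset_closedBall hlam hC h1 (n := k + 1) (by omega) hw
  rw [Metric.mem_closedBall] at h2
  rw [Metric.mem_ball]
  calc dist w 1 ≤ dist w (vertex lam C (k + 2)) + dist (vertex lam C (k + 2)) 1 :=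
        dist_triangle _ _ _
    _ < ε := by
        have : dist w (vertex lam C (k + 2)) ≤ Real.sin (edgeHalf lam C (k + 2)) := h2
        linarith

theorem convex_body (lam C τ : ℝ) : Convex ℝ (body lam C τ) := convex_convexHull ℝ _

theorem inner_le_of_mem_body (hlam : lam ∈ Ioo (0 : ℝ) 1) (hC : 0 < C) (h1 : ang lam C 1 ≤ Real.pi)
    (hτ : τ ∈ Icc (0 : ℝ) (1 / 2)) {m : ℕ} {θ : ℝ}
    (hθ : θ ∈ Icc (chainAng lam C τ (m + 1)) (chainAng lam C τ m)) {y : ℂ}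
    (hy : y ∈ body lam C τ) : inner ℝ y (dir θ) ≤
      (inner ℝ (chainCen lam C τ m + chainRad lam C τ m • dir θ) (dir θ) : ℝ) := by
  rw [body_eq hlam hC h1] at hy
  exact (closedArcChain hlam hC h1 hτ).inner_le_of_mem_convexHull hθ hy

theorem one_mem_body (hlam : lam ∈ Ioo (0 : ℝ) 1) (hC : 0 < C) (h1 : ang lam C 1 ≤ Real.pi)
    (hτ : τ ∈ Icc (0 : ℝ) (1 / 2)) : (1 : ℂ) ∈ body lam C τ :=
  subset_convexHull ℝ _ (Or.inr (one_mem_arc hlam hC h1 hτ))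

theorem re_le_one_of_mem_body (hlam : lam ∈ Ioo (0 : ℝ) 1) (hC : 0 < C) (h1 : ang lam C 1 ≤ Real.pi)
    (hτ : τ ∈ Icc (0 : ℝ) (1 / 2)) {y : ℂ} (hy : y ∈ body lam C τ) : y.re ≤ 1 := by
  have h := inner_le_of_mem_body hlam hC h1 hτ (m := 0) (θ := 2 * Real.pi)
    ⟨(firstEnd_lt hlam hC h1 hτ).le, le_rfl⟩ hy
  rw [dir_two_pi] at h
  simpa [Complex.inner, chainCen, chainRad] using h

theorem one_mem_frontier_body (hlam : lam ∈ Ioo (0 : ℝ) 1) (hC : 0 < C) (h1 : ang lam C 1 ≤ Real.pi)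
    (hτ : τ ∈ Icc (0 : ℝ) (1 / 2)) : (1 : ℂ) ∈ frontier (body lam C τ) := by
  refine ⟨subset_closure (one_mem_body hlam hC h1 hτ), fun h => ?_⟩
  obtain ⟨ε, hε, hεK⟩ := Metric.mem_nhds_iff.1 (mem_interior_iff_mem_nhds.1 h)
  have h2 : (1 : ℂ) + (ε / 2 : ℝ) ∈ body lam C τ := by
    refine hεK ?_
    rw [Metric.mem_ball, dist_eq_norm, add_sub_cancel_left, Complex.norm_real,
      Real.norm_of_nonneg (half_pos hε).le]
    exact half_lt_self hε
  have h3 := re_le_one_of_mem_body hlam hC h1 hτ h2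
  rw [Complex.add_re, Complex.one_re, Complex.ofReal_re] at h3
  linarith

/-- The interior is not empty, since `D` contains three different points of the unit circle. -/
theorem interior_body_nonempty (hlam : lam ∈ Ioo (0 : ℝ) 1) (hC : 0 < C)
    (h1 : ang lam C 1 ≤ Real.pi) (hτ : τ ∈ Icc (0 : ℝ) (1 / 2)) :
    (interior (body lam C τ)).Nonempty := by
  have hE := firstEnd_lt hlam hC h1 hτ
  have hE0 : 0 < firstEnd lam C τ :=
    (edgeAng_mem hlam hC h1 le_rfl).1.trans_le (firstEnd_mem hlam hC h1 hτ).1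
  set E := firstEnd lam C τ with hEdef
  have hinj : ∀ s ∈ Ico E (2 * Real.pi), ∀ t ∈ Ico E (2 * Real.pi), s ≠ t → dir s ≠ dir t :=
    fun s hs t ht hst h => hst (injOn_dir ⟨hE0.le.trans hs.1, hs.2⟩ ⟨hE0.le.trans ht.1, ht.2⟩ h)
  set d := (2 * Real.pi - E) / 3 with hd
  have hd0 : 0 < d := by rw [hd]; linarith
  have hmem : ∀ s ∈ Ico E (2 * Real.pi), dir s ∈ body lam C τ := by
    intro s hs
    have := arc_subset_body hlam hC h1 (τ := τ) (n := 0) (s := s) ⟨hs.1, hs.2.le⟩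
    simpa [chainCen, chainRad] using this
  have m0 : E ∈ Ico E (2 * Real.pi) := ⟨le_rfl, hE⟩
  have m1 : E + d ∈ Ico E (2 * Real.pi) := ⟨by linarith, by rw [hd]; linarith⟩
  have m2 : E + 2 * d ∈ Ico E (2 * Real.pi) := ⟨by linarith, by rw [hd]; linarith⟩
  have hcos : EuclideanGeometry.Cospherical ({dir E, dir (E + d), dir (E + 2 * d)} : Set ℂ) := by
    refine ⟨0, 1, ?_⟩
    rintro x (rfl | rfl | rfl) <;> simp [norm_dir]
  have hind : AffineIndependent ℝ ![dir E, dir (E + d), dir (E + 2 * d)] :=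
    hcos.affineIndependent_of_ne (hinj _ m0 _ m1 (by linarith))
      (hinj _ m0 _ m2 (by linarith)) (hinj _ m1 _ m2 (by linarith))
  rw [(convex_body lam C τ).interior_nonempty_iff_affineSpan_eq_top, eq_top_iff]
  have htop := hind.affineSpan_eq_top_iff_card_eq_finrank_add_one.2
    (by rw [Complex.finrank_real_complex]; rfl)
  rw [← htop]
  refine affineSpan_mono ℝ ?_
  rintro _ ⟨i, rfl⟩
  fin_cases i
  exacts [hmem _ m0, hmem _ m1, hmem _ m2]

end body

/-! ### Boundary of class `C^{1,1}` -/

theorem HasC11Boundary.of_translate {K : Set ℂ} (a : ℂ)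
    (h : HasC11Boundary ((fun x => x + a) ⁻¹' K)) : HasC11Boundary K := by
  obtain ⟨z, L, M, hL, hper, hinj, hrange, hdiff, hspeed, hlip, hleft⟩ := h
  have hd : ∀ s, deriv (fun s => z s + a) s = deriv z s := fun s => deriv_add_const a
  refine ⟨fun s => z s + a, L, M, hL, fun s => by simp only [hper s],
    fun s hs t ht hst => hinj hs ht (add_right_cancel hst), ?_, hdiff.add_const a,
    fun s => by rw [hd, hspeed], ?_, fun s w hw => ?_⟩
  · have h2 : frontier ((fun x => x + a) ⁻¹' K) = (fun x => x + a) ⁻¹' frontier K :=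
      ((Homeomorph.addRight a).preimage_frontier K).symm
    rw [range_comp' (fun x => x + a) z, hrange, h2]
    exact image_preimage_eq _ (Homeomorph.addRight a).surjective
  · rwa [show deriv (fun s => z s + a) = deriv z from funext hd]
  · have := hleft s (w - a) (by simpa using hw)
    rw [hd]
    rwa [show w - (z s + a) = w - a - z s by ring]

/-- A planar convex body in which a disc of positive radius rolls freely has a boundary of class
`C^{1,1}`. -/
theorem hasC11Boundary_of_roll {K : Set ℂ} (hK : IsCompact K) (hconv : Convex ℝ K)
    (hne : (interior K).Nonempty) {r : ℝ} (hr : 0 < r)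
    (hroll : ∀ x ∈ K, ∃ c, x ∈ Metric.closedBall c r ∧ Metric.closedBall c r ⊆ K) :
    HasC11Boundary K := by
  obtain ⟨a, ha⟩ := hne
  refine HasC11Boundary.of_translate a (hasC11Boundary_of_roll_of_mem_nhds ?_ ?_ ?_ hr ?_)
  · exact (Homeomorph.addRight a).isCompact_preimage.2 hK
  · exact hconv.translate_preimage_left a
  · refine (continuous_add_const a).continuousAt.preimage_mem_nhds ?_
    rw [zero_add]; exact mem_interior_iff_mem_nhds.1 ha
  · intro x hx
    obtain ⟨c, hc, hcK⟩ := hroll _ hx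
    refine ⟨c - a, ?_, fun y hy => hcK ?_⟩
    · rw [Metric.mem_closedBall, dist_eq_norm] at hc ⊢
      rwa [sub_sub_eq_add_sub]
    · rw [Metric.mem_closedBall, dist_eq_norm] at hy ⊢
      rwa [sub_sub_eq_add_sub] at hy

theorem hasC11Boundary_body {lam C τ : ℝ} (hlam : lam ∈ Ioo (0 : ℝ) 1) (hC : 0 < C)
    (h1 : ang lam C 1 ≤ Real.pi) (hτ : τ ∈ Icc (0 : ℝ) (1 / 2)) (hτ0 : 0 < τ) :
    HasC11Boundary (body lam C τ) := by
  obtain ⟨r, hr, hrn⟩ := exists_le_chainRad hlam hC h1 hτ hτ0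
  have hK := isCompact_body hlam hC h1 hτ
  refine hasC11Boundary_of_roll hK (convex_body lam C τ) (interior_body_nonempty hlam hC h1 hτ)
    hr ?_
  rw [body_eq hlam hC h1] at hK ⊢
  exact (closedArcChain_sub hlam hC h1 hτ hrn).roll hr.le hK.isClosed

/-! ### The metric projection -/

theorem IsNearest.unique {K : Set ℂ} (hconv : Convex ℝ K) {x p q : ℂ} (hp : IsNearest K x p)
    (hq : IsNearest K x q) : p = q := by
  have hpq : dist x p = dist x q := le_antisymm (hp.2 q hq.1) (hq.2 p hp.1)
  have hm := hp.2 _ (hconv.midpoint_mem hp.1 hq.1)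
  have h := parallelogram_law_with_norm ℝ (x - p) (x - q)
  have h2 : x - p + (x - q) = (2 : ℝ) • (x - midpoint ℝ p q) := by
    rw [midpoint_eq_smul_add, invOf_eq_inv]; module
  rw [h2, norm_smul, Real.norm_of_nonneg zero_le_two, ← dist_eq_norm x, ← dist_eq_norm x,
    ← dist_eq_norm x, ← hpq] at h
  have h3 : ‖x - p - (x - q)‖ * ‖x - p - (x - q)‖ ≤ 0 := by
    nlinarith [dist_nonneg (x := x) (y := p)]
  have h4 : ‖x - p - (x - q)‖ = 0 := by nlinarith [norm_nonneg (x - p - (x - q))]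
  rw [norm_eq_zero, sub_sub_sub_cancel_left, sub_eq_zero] at h4
  exact h4.symm

theorem isNearest_iff_eq_metricProj {K : Set ℂ} (hK : IsCompact K) (hconv : Convex ℝ K)
    (hne : K.Nonempty) (x p : ℂ) : IsNearest K x p ↔ p = metricProj K x := by
  have hex : ∃ p, IsNearest K x p := by
    obtain ⟨p, hp, hmin⟩ := hK.exists_isMinOn hne (continuous_const.dist continuous_id).continuousOn
    exact ⟨p, hp, fun y hy => hmin hy⟩
  have hspec : IsNearest K x (metricProj K x) := by
    rw [metricProj, dif_pos hex]; exact hex.choose_spec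
  exact ⟨fun h => h.unique hconv hspec, fun h => h ▸ hspec⟩

theorem isNearest_of_inner_nonpos {K : Set ℂ} {x p : ℂ} (hp : p ∈ K)
    (h : ∀ y ∈ K, inner ℝ (x - p) (y - p) ≤ 0) : IsNearest K x p := by
  refine ⟨hp, fun y hy => ?_⟩
  rw [dist_eq_norm, dist_eq_norm, ← sq_le_sq₀ (norm_nonneg _) (norm_nonneg _),
    show x - y = (x - p) - (y - p) by ring, norm_sub_sq_real (x - p) (y - p)]
  nlinarith [h y hy, sq_nonneg ‖y - p‖]

/-! ### The projection along the orbit -/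

theorem orbit_two_mul (θ : ℝ) : orbit (2 * θ) = 2 * dir θ := by
  rw [orbit, dir]; congr 2; push_cast; ring

section projection

variable {lam C τ : ℝ}

theorem metricProj_eq (hlam : lam ∈ Ioo (0 : ℝ) 1) (hC : 0 < C) (h1 : ang lam C 1 ≤ Real.pi)
    (hτ : τ ∈ Icc (0 : ℝ) (1 / 2)) {x p : ℂ} (hp : p ∈ body lam C τ)
    (h : ∀ y ∈ body lam C τ, inner ℝ (x - p) (y - p) ≤ 0) : metricProj (body lam C τ) x = p :=
  ((isNearest_iff_eq_metricProj (isCompact_body hlam hC h1 hτ) (convex_body lam C τ) ⟨p, hp⟩ x p).1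
    (isNearest_of_inner_nonpos hp h)).symm

theorem metricProj_orbit_zero (hlam : lam ∈ Ioo (0 : ℝ) 1) (hC : 0 < C) (h1 : ang lam C 1 ≤ Real.pi)
    (hτ : τ ∈ Icc (0 : ℝ) (1 / 2)) : metricProj (body lam C τ) (orbit 0) = 1 := by
  refine metricProj_eq hlam hC h1 hτ (one_mem_body hlam hC h1 hτ) fun y hy => ?_
  have h := re_le_one_of_mem_body hlam hC h1 hτ hy
  have h2 : orbit 0 - 1 = 1 := by norm_num [orbit]
  rw [h2]
  simpa [Complex.inner] using h

/-- If `ε` is small, then the point of the orbit of direction angle `edgeAng n - ε` projects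
orthogonally to the edge number `n`. -/
theorem metricProj_orbit_edge (hlam : lam ∈ Ioo (0 : ℝ) 1) (hC : 0 < C) (h1 : ang lam C 1 ≤ Real.pi)
    (hτ : τ ∈ Icc (0 : ℝ) (1 / 2)) {n : ℕ} (hn : 2 ≤ n) {ε : ℝ} (hε : 0 ≤ ε)
    (hεδ : ε ≤ edgeHalf lam C n)
    (hεs : 2 * Real.sin ε ≤ Real.sin (edgeHalf lam C n) - Real.sin (edgeHalf lam C (n + 1))) :
    metricProj (body lam C τ) (orbit (2 * (edgeAng lam C n - ε))) =
      Real.cos (edgeHalf lam C n) • dir (edgeAng lam C n) -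
        (2 * Real.sin ε) • (Complex.I * dir (edgeAng lam C n)) := by
  have hδ := edgeHalf_mem hlam hC h1 (n := n) (by omega)
  have hpi := Real.pi_pos
  obtain ⟨k, rfl⟩ := Nat.exists_eq_add_of_le' hn
  set φ := edgeAng lam C (k + 2) with hφ
  set δ := edgeHalf lam C (k + 2) with hδdef
  set d := Real.sin δ - Real.sin (edgeHalf lam C (k + 2 + 1)) with hd
  have hsε : 0 ≤ Real.sin ε :=
    Real.sin_nonneg_of_nonneg_of_le_pi hε (by linarith [hδ.2])
  have hT : Real.cos δ • dir φ ∈ body lam C τ := by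
    have h := arc_subset_body hlam hC h1 (τ := τ) (n := k + 2) (s := φ)
      ⟨le_rfl, (edgeAng_succ_lt hlam hC (k + 1)).le⟩
    have h2 := arcCen_add_start (lam := lam) (C := C) (k + 1)
    simp only [chainCen, chainRad] at h
    rwa [h2] at h
  have hS : Real.cos δ • dir φ - d • (Complex.I * dir φ) ∈ body lam C τ := by
    have h := arc_subset_body hlam hC h1 (τ := τ) (n := k + 3) (s := φ)
      ⟨(edgeAng_succ_lt hlam hC (k + 2)).le, le_rfl⟩
    have h2 := arcCen_add_end hlam hC h1 (n := k + 2) (by omega)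
    simp only [chainCen, chainRad] at h
    rwa [h2] at h
  have hp : Real.cos δ • dir φ - (2 * Real.sin ε) • (Complex.I * dir φ) ∈ body lam C τ := by
    rcases (by linarith : 0 ≤ d).eq_or_lt with h0 | h0
    · have : Real.sin ε = 0 := by linarith
      simpa [this] using hT
    · have h2 := convex_body lam C τ hT hS (a := 1 - 2 * Real.sin ε / d) (b := 2 * Real.sin ε / d)
        (by rw [sub_nonneg, div_le_one h0]; exact hεs) (by positivity) (by ring)
      convert h2 using 1
      match_scalars
      · ring
      · field_simp
  refine metricProj_eq hlam hC h1 hτ hp fun y hy => ?_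
  have hsupp := inner_le_of_mem_body hlam hC h1 hτ (m := k + 2) (θ := φ)
    ⟨le_rfl, (edgeAng_succ_lt hlam hC (k + 1)).le⟩ hy
  have h2 := arcCen_add_start (lam := lam) (C := C) (k + 1)
  simp only [chainCen, chainRad] at hsupp
  rw [h2, real_inner_smul_left, inner_dir_dir, sub_self, Real.cos_zero, mul_one,
    real_inner_comm] at hsupp
  have hx : orbit (2 * (φ - ε)) -
      (Real.cos δ • dir φ - (2 * Real.sin ε) • (Complex.I * dir φ)) =
      (2 * Real.cos ε - Real.cos δ) • dir φ := by
    rw [orbit_two_mul, sub_eq_add_neg φ, dir_add, dir_eq (-ε), Real.cos_neg, Real.sin_neg]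
    simp only [Complex.real_smul]; push_cast; ring
  have hcos : 0 ≤ 2 * Real.cos ε - Real.cos δ := by
    have h3 : Real.cos δ ≤ Real.cos ε :=
      Real.cos_le_cos_of_nonneg_of_le_pi hε (by linarith [hδ.2]) hεδ
    have h4 : 0 ≤ Real.cos ε := Real.cos_nonneg_of_mem_Icc ⟨by linarith, by linarith [hδ.2]⟩
    linarith
  rw [hx, real_inner_smul_left]
  refine mul_nonpos_of_nonneg_of_nonpos hcos ?_
  rw [inner_sub_right, inner_sub_right, real_inner_smul_right, real_inner_smul_right, inner_dir_dir,
    inner_dir_I_mul_dir, sub_self, Real.cos_zero, Real.sin_zero]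
  linarith

/-- A derivative `v` of the projection is the limit of the difference quotients along the points of
direction angle `edgeAng n - κ α_n`, for each small `κ`. -/
theorem eq_of_tendsto_slope (hlam : lam ∈ Ioo (0 : ℝ) 1) (hC : 0 < C) (h1 : ang lam C 1 ≤ Real.pi)
    (hτ : τ ∈ Icc (0 : ℝ) (1 / 2)) {v : ℂ} (hv : Tendsto
      (fun t : ℝ => (metricProj (body lam C τ) (orbit t) - metricProj (body lam C τ) (orbit 0)) /
        (t : ℂ)) (𝓝[>] 0) (𝓝 v)) {κ : ℝ} (hκ : 0 ≤ κ) (hκ' : κ ≤ (1 - lam) ^ 2 / 8) :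
    v * (2 * ((1 + lam) / 2 - κ) : ℝ) = ((1 + lam) / 2 - 2 * κ : ℝ) * Complex.I := by
  have hl := hlam.1
  have hl' : 0 < 1 - lam := sub_pos.2 hlam.2
  set a := (1 + lam) / 2 with ha
  set b := (1 - lam) / 2 with hb
  have haκ : 0 < 2 * (a - κ) := by rw [ha]; nlinarith
  have hκb : κ ≤ b := by rw [hb]; nlinarith
  rw [metricProj_orbit_zero hlam hC h1 hτ] at hv
  have hA0 : Tendsto (ang lam C) atTop (𝓝[>] 0) :=
    tendsto_nhdsWithin_iff.2 ⟨ang_tendsto hlam, Eventually.of_forall fun n => ang_pos hlam hC n⟩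
  -- for large `n`, the projection lies between `S_{n+1}` and `T_n`
  have hG : HasDerivAt (fun x => Real.sin (x * b) - Real.sin (x * (lam * b)) - 2 * Real.sin (x * κ))
      (b - lam * b - 2 * κ) 0 := by
    have hsin : ∀ c : ℝ, HasDerivAt (fun x => Real.sin (x * c)) c 0 := fun c => by
      simpa using ((hasDerivAt_id (0 : ℝ)).mul_const c).sin
    exact ((hsin b).sub (hsin (lam * b))).sub ((hsin κ).const_mul 2)
  have hGpos : 0 < b - lam * b - 2 * κ := by rw [hb]; nlinarith
  have hEv : ∀ᶠ n in atTop, 2 * Real.sin (ang lam C n * κ) ≤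
      Real.sin (edgeHalf lam C n) - Real.sin (edgeHalf lam C (n + 1)) := by
    have h2 := (hasDerivAt_iff_tendsto_slope.1 hG).mono_left
      (nhdsWithin_mono 0 fun x (hx : 0 < x) => hx.ne')
    filter_upwards [(h2.comp hA0).eventually (lt_mem_nhds hGpos)] with n hn
    have h3 := ang_pos hlam hC n
    simp only [Function.comp, slope_def_field, zero_mul, Real.sin_zero, mul_zero, sub_zero] at hn
    have h4 := (div_pos_iff_of_pos_right h3).1 hn
    rw [edgeHalf_eq, edgeHalf_eq, ang_succ, mul_assoc _ lam]
    linarith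
  set F : ℝ → ℂ := fun x => Real.cos (x * b) • dir (x * a) -
    (2 * Real.sin (x * κ)) • (Complex.I * dir (x * a)) with hF
  have hproj : ∀ᶠ n in atTop,
      metricProj (body lam C τ) (orbit (2 * (a - κ) * ang lam C n)) = F (ang lam C n) := by
    filter_upwards [hEv, eventually_ge_atTop 2] with n hn h2
    have h3 := ang_pos hlam hC n
    have h := metricProj_orbit_edge hlam hC h1 hτ h2 (mul_nonneg h3.le hκ)
      (by rw [edgeHalf_eq]; exact mul_le_mul_of_nonneg_left hκb h3.le) hn
    rw [edgeHalf_eq, edgeAng_eq] at h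
    rw [show 2 * (a - κ) * ang lam C n = 2 * (ang lam C n * a - ang lam C n * κ) by ring]
    exact h
  have hFd : HasDerivAt F ((a - 2 * κ : ℝ) * Complex.I) 0 := by
    have hdir : HasDerivAt (fun x => dir (x * a)) (a • Complex.I) 0 := by
      have h2 : HasDerivAt (fun x : ℝ => x * a) a 0 := by
        simpa using (hasDerivAt_id (0 : ℝ)).mul_const a
      have h3 := (hasDerivAt_dir (0 * a)).scomp (0 : ℝ) h2
      refine h3.congr_deriv ?_
      simp [dir]
    have hcos : HasDerivAt (fun x => Real.cos (x * b)) 0 0 := by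
      simpa using ((hasDerivAt_id (0 : ℝ)).mul_const b).cos
    have hsin : HasDerivAt (fun x => 2 * Real.sin (x * κ)) (2 * κ) 0 := by
      simpa using (((hasDerivAt_id (0 : ℝ)).mul_const κ).sin).const_mul 2
    refine ((hcos.smul hdir).sub (hsin.smul (hdir.const_mul Complex.I))).congr_deriv ?_
    simp [dir]
    ring
  have hF0 : F 0 = 1 := by simp [hF, dir]
  have hlim1 : Tendsto (fun n => (F (ang lam C n) - 1) / (ang lam C n : ℂ)) atTop
      (𝓝 ((a - 2 * κ : ℝ) * Complex.I)) := by
    have h2 := (hasDerivAt_iff_tendsto_slope.1 hFd).mono_left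
      (nhdsWithin_mono 0 fun x (hx : 0 < x) => hx.ne')
    refine (h2.comp hA0).congr fun n => ?_
    simp only [Function.comp, slope, hF0, sub_zero, vsub_eq_sub, Complex.real_smul]
    push_cast
    rw [inv_mul_eq_div]
  have ht : Tendsto (fun n => 2 * (a - κ) * ang lam C n) atTop (𝓝[>] 0) := by
    refine tendsto_nhdsWithin_iff.2 ⟨?_, Eventually.of_forall fun n =>
      mul_pos haκ (ang_pos hlam hC n)⟩
    simpa using (ang_tendsto hlam).const_mul (2 * (a - κ))
  have hlim2 := (hv.comp ht).mul_const ((2 * (a - κ) : ℝ) : ℂ)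
  refine tendsto_nhds_unique hlim2 (hlim1.congr' ?_)
  filter_upwards [hproj] with n hn
  have h3 : (ang lam C n : ℂ) ≠ 0 := Complex.ofReal_ne_zero.2 (ang_pos hlam hC n).ne'
  have h4 : ((2 * (a - κ) : ℝ) : ℂ) ≠ 0 := Complex.ofReal_ne_zero.2 haκ.ne'
  simp only [Function.comp, hn]
  rw [Complex.ofReal_mul _ (ang lam C n)]
  field_simp

end projection

end RoundedShapiro

theorem mainTheorem3 (lam C τ : ℝ) (hlam : lam ∈ Ioo (0 : ℝ) 1) (hC : 0 < C)
    (hang : ∀ n : ℕ, 1 ≤ n → RoundedShapiro.ang lam C n ∈ Ioc 0 Real.pi)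
    (hτ : τ ∈ Icc (0 : ℝ) (1 / 2)) :
    -- the set is a convex body
    IsCompact (RoundedShapiro.body lam C τ) ∧
    Convex ℝ (RoundedShapiro.body lam C τ) ∧
    (interior (RoundedShapiro.body lam C τ)).Nonempty ∧
    -- its boundary is of class C^{1,1} as soon as the corner at the first vertex is rounded off
    (0 < τ → RoundedShapiro.HasC11Boundary (RoundedShapiro.body lam C τ)) ∧
    -- the metric projection is well defined, and the starting point of the orbit projects to 1
    (∀ x p : ℂ, RoundedShapiro.IsNearest (RoundedShapiro.body lam C τ) x p ↔
      p = RoundedShapiro.metricProj (RoundedShapiro.body lam C τ) x) ∧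
    (1 : ℂ) ∈ frontier (RoundedShapiro.body lam C τ) ∧
    RoundedShapiro.metricProj (RoundedShapiro.body lam C τ) (RoundedShapiro.orbit 0) = 1 ∧
    -- there is no one-sided derivative of the projection along the orbit
    ¬ ∃ v : ℂ, Tendsto
      (fun t : ℝ =>
        (RoundedShapiro.metricProj (RoundedShapiro.body lam C τ) (RoundedShapiro.orbit t) -
          RoundedShapiro.metricProj (RoundedShapiro.body lam C τ) (RoundedShapiro.orbit 0)) /
          (t : ℂ))
      (𝓝[>] 0) (𝓝 v) := by
  open RoundedShapiro in
  have h1 : ang lam C 1 ≤ Real.pi := (hang 1 le_rfl).2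
  have hK := isCompact_body hlam hC h1 hτ
  refine ⟨hK, convex_body lam C τ, interior_body_nonempty hlam hC h1 hτ,
    hasC11Boundary_body hlam hC h1 hτ,
    isNearest_iff_eq_metricProj hK (convex_body lam C τ) ⟨1, one_mem_body hlam hC h1 hτ⟩,
    one_mem_frontier_body hlam hC h1 hτ, metricProj_orbit_zero hlam hC h1 hτ, ?_⟩
  rintro ⟨v, hv⟩
  have hl : 0 < 1 - lam := sub_pos.2 hlam.2
  -- along the points `T_n` the slope tends to `i / 2`, along other points of the edges it does not
  have e1 := eq_of_tendsto_slope hlam hC h1 hτ hv le_rfl (by positivity)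
  have e2 := eq_of_tendsto_slope hlam hC h1 hτ hv (κ := (1 - lam) ^ 2 / 8) (by positivity) le_rfl
  have i1 := congrArg Complex.im e1
  have i2 := congrArg Complex.im e2
  rw [Complex.im_mul_ofReal, Complex.im_ofReal_mul, Complex.I_im] at i1 i2
  have h2 : v.im = 1 / 2 := by
    have : 1 + lam ≠ 0 := by linarith [hlam.1]
    apply mul_right_cancel₀ this
    linarith
  rw [h2] at i2
  nlinarith [pow_pos hl 2]
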